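/- Let $F=\mathbb F_q$ be a finite field. For $\ell\ge 1$ and $a,b\in F[x]$ of degree less than $\ell$, let $A,B$ be the $\ell\times\ell$ circulant matrices with entries $A_{ij}=a_{i-j \bmod \ell}$, $B_{ij}=b_{i-j\bmod \ell}$. The generalized bicycle code $\mathrm{GB}(a,b)$ of length $n=2\ell$ is the CSS code with generator matrices $H_X=(A\mid B)$ and $H_Z^T=\binom{B}{-A}$. It encodes $k=n-\operatorname{rank}H_X-\operatorname{rank}H_Z$ qudits; for $k>0$ its distance $d$ is the minimum Hamming weight of a vector that lies in $\ker H_X$ but not in the row space of $H_Z$, or in $\ker H_Z$ but not in the row space of $H_X$. Its row weight is $w=\operatorname{wgt}(a)+\operatorname{wgt}(b)$. It is incommensurate if there is no factor $\Delta>1$ of $\ell$ with $a(x)=a_0(x^\Delta)$, $b(x)=b_0(x^\Delta)$ for some polynomials $a_0,b_0$. A CSS code is local in $D$ dimensions, with at most $m$ qudits per site and range $r$, if its qudits can be placed at points of $\mathbb Z^D$, at most $m$ at each point, so that the support of each row of $H_X$ and of $H_Z$ has sup-norm diameter at most $r$. Two CSS codes are equivalent if a bijection of their qudits together with a rescaling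 of each qudit by a non-zero scalar (inverse scalars on the $X$ and the $Z$ side) carries the row spaces of $H_X$, $H_Z$ of one to those of the other. (1) For every $w\ge2$ there are constants $r=r(w)$ and $K=K(w)$, independent of $q$ and $\ell$, such that for every incommensurate code $\mathrm{GB}(a,b)$ of row weight $w$ there is a dimension $D$ with $1\le D\le w-1$, and $D\le w-2$ if $\ell$ is prime, $a,b\neq0$ and $w\ge3$, such that $\mathrm{GB}(a,b)$ is equivalent to a CSS code local in $D$ dimensions with at most two qudits per site and range $r$, and, if $k>0$, $$d\le K\,n^{1-1/D}\qquad\text{and, if } D\ge2,\qquad k\,d^{2/(D-1)}\le K\,n .$$ (2) More generally, for all $D\ge1$, $m$, $r$ there is a constant $K$ such that these inequalities hold for every GB code with $k>0$ that is equivalent to a CSS code local in $D$ dimensions with at most $m$ qudits per site and range $r$. (3) For every sequence of GB codes of a fixed row weight $w$ with parameters $[[n_i,k_i,d_i]]_{q_i}$ and $d_i\to\infty$, one has $k_i/n_i\to0$. -/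

import Mathlib

/-- A CSS code over the field `F` with qudits `Q`: two generator matrices with orthogonal rows. -/
structure CSSCode (F : Type*) [Field F] (RX RZ Q : Type*) [Fintype Q] where
  HX : Matrix RX Q F
  HZ : Matrix RZ Q F
  orth : HX * HZ.transpose = 0

namespace CSSCode

variable {F : Type*} [Field F] {RX RZ Q RX' RZ' Q' : Type*} [Fintype Q] [Fintype Q']

/-- The space generated by the rows of `HX`. -/
def stabX (C : CSSCode F RX RZ Q) : Submodule F (Q → F) :=
  Submodule.span F (Set.range C.HX.row)

/-- The space generated by the rows of `HZ`. -/
def stabZ (C : CSSCode F RX RZ Q) : Submodule F (Q → F) :=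
  Submodule.span F (Set.range C.HZ.row)

/-- The number of encoded qudits, `k = n - rank HX - rank HZ`; by orthogonality of the rows,
`rank HX + rank HZ ≤ n`, so the subtraction does not truncate. -/
noncomputable def numLogical (C : CSSCode F RX RZ Q) : ℕ :=
  Fintype.card Q - C.HX.rank - C.HZ.rank

/-- Non-trivial codewords: `Z`-like vectors (orthogonal to the rows of `HX`, not generated by the
rows of `HZ`) together with `X`-like vectors (the same with `X` and `Z` exchanged). -/
def nontrivialWords (C : CSSCode F RX RZ Q) : Set (Q → F) :=
  {c | C.HX.mulVec c = 0 ∧ c ∉ C.stabZ} ∪ {c | C.HZ.mulVec c = 0 ∧ c ∉ C.stabX}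

open Classical in
/-- The distance `d = min (d_X, d_Z)`: the minimum Hamming weight of a non-trivial codeword.
It is meaningful when `k > 0`; for `k = 0` there are no non-trivial words and the value is `0`. -/
noncomputable def distance (C : CSSCode F RX RZ Q) : ℕ :=
  sInf ((fun c : Q → F => hammingNorm c) '' C.nontrivialWords)

/-- Equivalence of CSS codes: a relabelling `σ` of the qudits, together with a rescaling of each
qudit by a non-zero scalar (inverse scalars on the `X` and the `Z` side), carries the two
stabilizer spaces of `C` to those of `C'`. The generating matrices themselves may differ. -/
def Equivalent (C : CSSCode F RX RZ Q) (C' : CSSCode F RX' RZ' Q') : Prop :=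
  ∃ (σ : Q ≃ Q') (u : Q → Fˣ),
    (∀ v : Q → F, v ∈ C.stabX ↔
      (fun p => (u (σ.symm p) : F) * v (σ.symm p)) ∈ C'.stabX) ∧
    (∀ v : Q → F, v ∈ C.stabZ ↔
      (fun p => (u (σ.symm p) : F)⁻¹ * v (σ.symm p)) ∈ C'.stabZ)

/-- The code is local in `D` dimensions: its qudits can be placed at vertices of the hypercubic
lattice `ℤ^D`, at most `m` at each vertex, such that the support of every row of `HX` and of `HZ`
has diameter at most `r` (in the sup-metric). -/
def IsLocal (C : CSSCode F RX RZ Q) (D m r : ℕ) : Prop :=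
  ∃ pos : Q → (Fin D → ℤ),
    (∀ x : Fin D → ℤ, Set.ncard {p | pos p = x} ≤ m) ∧
    (∀ (i : RX) (p p' : Q), C.HX i p ≠ 0 → C.HX i p' ≠ 0 →
      ∀ j, |pos p j - pos p' j| ≤ (r : ℤ)) ∧
    (∀ (i : RZ) (p p' : Q), C.HZ i p ≠ 0 → C.HZ i p' ≠ 0 →
      ∀ j, |pos p j - pos p' j| ≤ (r : ℤ))

/-- The code is equivalent to some CSS code that is local in `D` dimensions. -/
def EquivalentToLocal (C : CSSCode F RX RZ Q) (D m r : ℕ) : Prop :=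
  ∃ (s t : ℕ) (C' : CSSCode F (Fin s) (Fin t) (Fin (Fintype.card Q))),
    C.Equivalent C' ∧ C'.IsLocal D m r

end CSSCode

namespace GB

variable {F : Type*} [Field F]

/-- The `ℓ × ℓ` circulant matrix `a(P)`, with entries `a_{i - j mod ℓ}` (for `deg a < ℓ`). -/
def circ (ℓ : ℕ) (a : Polynomial F) : Matrix (ZMod ℓ) (ZMod ℓ) F :=
  Matrix.circulant fun i : ZMod ℓ => a.coeff i.val

/-- The generalized bicycle code `GB(a, b)` of length `2ℓ`:
`HX = (A | B)` and `HZᵀ = (B ; -A)`. -/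
def code (ℓ : ℕ) [NeZero ℓ] (a b : Polynomial F) :
    CSSCode F (ZMod ℓ) (ZMod ℓ) (ZMod ℓ ⊕ ZMod ℓ) where
  HX := Matrix.fromCols (circ ℓ a) (circ ℓ b)
  HZ := (Matrix.fromRows (circ ℓ b) (-circ ℓ a)).transpose
  orth := by
    rw [Matrix.transpose_transpose, Matrix.fromCols_mul_fromRows, Matrix.mul_neg]
    unfold circ
    rw [Matrix.circulant_mul_comm, add_neg_cancel]

/-- The total weight of the two polynomials, which is the weight of every row of `HX` and `HZ`
when the degrees are smaller than `ℓ`. -/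
def rowWeight (a b : Polynomial F) : ℕ := a.support.card + b.support.card

/-- `GB(a, b)` is incommensurate: there is no factor `Δ > 1` of `ℓ` with `a(x) = a₀(x^Δ)` and
`b(x) = b₀(x^Δ)`. -/
def Incommensurate (ℓ : ℕ) (a b : Polynomial F) : Prop :=
  ¬ ∃ Δ : ℕ, 1 < Δ ∧ Δ ∣ ℓ ∧
    ∃ a₀ b₀ : Polynomial F, a = a₀.comp (Polynomial.X ^ Δ) ∧ b = b₀.comp (Polynomial.X ^ Δ)

/-- The inequalities `d ≤ K n^{1 - 1/D}` and `k d^{2/(D-1)} ≤ K n` for the parameters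
`[[n = 2ℓ, k, d]]` of `GB(a, b)`. For `D = 1` the second exponent is undefined, and only the first
inequality (`d ≤ K`) is meant. -/
def ParameterBounds (ℓ : ℕ) [NeZero ℓ] (a b : Polynomial F) (D : ℕ) (K : ℝ) : Prop :=
  ((code ℓ a b).distance : ℝ) ≤ K * (2 * ℓ : ℝ) ^ (1 - 1 / (D : ℝ)) ∧
  (2 ≤ D → ((code ℓ a b).numLogical : ℝ) *
    ((code ℓ a b).distance : ℝ) ^ (2 / ((D : ℝ) - 1)) ≤ K * (2 * ℓ : ℝ))

end GB

/-! Two independent facts combine.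

First, codes local in D dimensions obey trade-offs of Bravyi–Terhal and Bravyi–Poulin–Terhal type.
Call a region correctable if it supports no non-trivial codeword. Sets of fewer than d qudits are
correctable; a correctable region can be enlarged by a correctable layer containing its boundary
(`Correctable.union`), and correctable regions not connected by generators can be merged
(`correctable_of_cells`). Hence a cube is correctable as long as its surface layers hold fewer than
d qudits, that is, for D ≥ 2, up to a side R of order d^{1/(D-1)}. Cut space into such cubes by
walls of thickness r. If k > 0, the walls hold at least d qudits, since otherwise everything would
be correctable; averaging over shifts of the walls gives dR = O(n). The walls minus a neighbourhood
of their pairwise intersections are correctable too, and two correctable regions leave at least k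
qudits uncovered (`numLogical_le_ncard`), so kR² = O(n).

Second, GB codes are local. Shifting the two blocks of qudits against each other cancels one
reference exponent in each non-zero polynomial, and it remains to place the Cayley graph of ℤ/ℓ with
N generators into ℤ^N with short edges. The generated subgroup is a discrete torus ℤ^N/Λ. A reduced
basis of Λ has coordinate functionals and denominators controlled in terms of N alone, by minimality
and Dirichlet approximation. In these coordinates the torus is folded onto a box, and the boundedly
many sheets are told apart by residues (`exists_folding`), so no extra dimension is needed. -/

namespace CSSCode

open Matrix

variable {F : Type*} [Field F] {RX RZ Q RX' RZ' Q' : Type*} [Fintype Q] [Fintype Q']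

/-! ### Correctable regions, cleaning, and the number of logical qudits -/

/-- Exchange of the roles of `X` and `Z`. -/
def swap (C : CSSCode F RX RZ Q) : CSSCode F RZ RX Q where
  HX := C.HZ
  HZ := C.HX
  orth := by
    have h := congrArg Matrix.transpose C.orth
    rwa [Matrix.transpose_mul, Matrix.transpose_transpose, Matrix.transpose_zero] at h

/-- The kernel of `HX` is the orthogonal complement of the `X` stabilizers. -/
theorem HX_mulVec_eq_zero_iff (C : CSSCode F RX RZ Q) (c : Q → F) :
    C.HX *ᵥ c = 0 ↔ ∀ v ∈ C.stabX, v ⬝ᵥ c = 0 := by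
  constructor
  · intro h v hv
    refine Submodule.span_induction (p := fun v _ => v ⬝ᵥ c = 0) ?_ ?_ ?_ ?_ hv
    · rintro _ ⟨i, rfl⟩
      exact congrFun h i
    · simp
    · intro x y _ _ hx hy
      rw [add_dotProduct, hx, hy, add_zero]
    · intro a x _ hx
      rw [smul_dotProduct, hx, smul_zero]
  · intro h
    funext i
    exact h _ (Submodule.subset_span ⟨i, rfl⟩)

theorem HX_mulVec_of_mem_stabZ (C : CSSCode F RX RZ Q) {c : Q → F} (hc : c ∈ C.stabZ) :
    C.HX *ᵥ c = 0 := by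
  have : C.stabZ ≤ LinearMap.ker C.HX.mulVecLin := by
    refine Submodule.span_le.2 ?_
    rintro _ ⟨i, rfl⟩
    rw [SetLike.mem_coe, LinearMap.mem_ker, Matrix.mulVecLin_apply]
    funext j
    exact congrFun (congrFun C.orth j) i
  exact this hc

/-- A region is correctable if it supports no non-trivial codewords. -/
def Correctable (C : CSSCode F RX RZ Q) (U : Set Q) : Prop :=
  ∀ c : Q → F, (∀ q, q ∉ U → c q = 0) →
    (C.HX *ᵥ c = 0 → c ∈ C.stabZ) ∧ (C.HZ *ᵥ c = 0 → c ∈ C.stabX)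

theorem Correctable.swap {C : CSSCode F RX RZ Q} {U : Set Q} (h : C.Correctable U) :
    C.swap.Correctable U := fun c hc => (h c hc).symm

theorem Correctable.mono {C : CSSCode F RX RZ Q} {U V : Set Q} (h : C.Correctable V)
    (hUV : U ⊆ V) : C.Correctable U :=
  fun c hc => h c fun q hq => hc q fun hU => hq (hUV hU)

theorem correctable_of_ncard_lt (C : CSSCode F RX RZ Q) {U : Set Q}
    (h : U.ncard < C.distance) : C.Correctable U := by
  classical
  intro c hc
  have key : c ∉ C.nontrivialWords := by
    intro hmem
    have h1 : C.distance ≤ hammingNorm c := by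
      unfold distance
      convert Nat.sInf_le (Set.mem_image_of_mem (fun c : Q → F => hammingNorm c) hmem)
    have h2 : hammingNorm c ≤ U.ncard := by
      unfold hammingNorm
      rw [← Set.ncard_coe_finset]
      refine Set.ncard_le_ncard (fun q hq => ?_) (Set.toFinite U)
      by_contra hU
      exact (by simpa using hq : c q ≠ 0) (hc q hU)
    omega
  simp only [nontrivialWords, Set.mem_union, Set.mem_ofPred_eq, not_or, not_and, not_not] at key
  exact key

/-- The linear map that sets the coordinates outside `U` to zero. -/
noncomputable def restrictTo (F : Type*) {Q : Type*} [Field F] (U : Set Q) : (Q → F) →ₗ[F] (Q → F) where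
  toFun c := U.indicator c
  map_add' x y := Set.indicator_add U x y
  map_smul' a x := by
    ext q
    by_cases hq : q ∈ U <;> simp [hq]

@[simp] theorem restrictTo_apply {Q : Type*} (U : Set Q) (c : Q → F) :
    restrictTo F U c = U.indicator c := rfl

/-- Cleaning: on a correctable region, a word can be cancelled using only the stabilizer
generators that meet the region. -/
theorem Correctable.exists_clean {C : CSSCode F RX RZ Q} {U : Set Q} (h : C.Correctable U)
    {c : Q → F} (hc : C.HX *ᵥ c = 0) :
    ∃ s ∈ Submodule.span F {v | ∃ i, v = C.HZ.row i ∧ ∃ q ∈ U, C.HZ i q ≠ 0},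
      ∀ q ∈ U, s q = c q := by
  classical
  set S := Submodule.span F {v | ∃ i, v = C.HZ.row i ∧ ∃ q ∈ U, C.HZ i q ≠ 0} with hS
  by_cases hmem : restrictTo F U c ∈ S.map (restrictTo F U)
  · obtain ⟨s, hs, hsc⟩ := hmem
    refine ⟨s, hs, fun q hq => ?_⟩
    simpa [hq] using congrFun hsc q
  · exfalso
    -- Duality: the separating functional is the pairing with a vector `e` supported in `U`. It is
    -- orthogonal to every row of `HZ`, so correctability makes it an `X` stabilizer, and those pair
    -- to zero with `c`.
    obtain ⟨f, hf, hker⟩ := Submodule.exists_le_ker_of_notMem hmem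
    set g := f ∘ₗ restrictTo F U with hg
    let e : Q → F := fun q => g fun j => if q = j then 1 else 0
    have hge : ∀ x, g x = x ⬝ᵥ e := by
      intro x
      rw [LinearMap.pi_apply_eq_sum_univ g x]
      rfl
    have heU : ∀ q, q ∉ U → e q = 0 := by
      intro q hq
      have : restrictTo F U (fun j => if q = j then (1 : F) else 0) = 0 := by
        ext j
        rw [restrictTo_apply, Set.indicator_apply, Pi.zero_apply]
        split_ifs with h1 h2
        · exact absurd (h2 ▸ h1) hq
        · rfl
        · rfl
      change f (restrictTo F U _) = 0
      rw [this, map_zero]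
    have heZ : C.HZ *ᵥ e = 0 := by
      funext i
      change C.HZ.row i ⬝ᵥ e = 0
      rw [← hge]
      change f (restrictTo F U _) = 0
      by_cases hi : ∃ q ∈ U, C.HZ i q ≠ 0
      · exact hker (Submodule.mem_map_of_mem (Submodule.subset_span ⟨i, rfl, hi⟩))
      · push Not at hi
        have : restrictTo F U (C.HZ.row i) = 0 := by
          ext q
          rw [restrictTo_apply, Set.indicator_apply, Pi.zero_apply]
          split_ifs with h1
          · exact hi q h1
          · rfl
        rw [this, map_zero]
    have heX := (h e heU).2 heZ
    have h0 := (C.HX_mulVec_eq_zero_iff c).1 hc e heX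
    rw [dotProduct_comm, ← hge] at h0
    exact hf h0

/-- Clean `c` on `U` using generators that meet `U`. By `hZ` they do not leave `U ∪ T`, so the
remainder is a word supported in `T`. -/
theorem Correctable.union_aux {C : CSSCode F RX RZ Q} {U T : Set Q} (hU : C.Correctable U)
    (hT : C.Correctable T)
    (hZ : ∀ i, ∀ q ∈ U, C.HZ i q ≠ 0 → ∀ q', C.HZ i q' ≠ 0 → q' ∈ U ∪ T)
    {c : Q → F} (hcs : ∀ q, q ∉ U ∪ T → c q = 0) (hc : C.HX *ᵥ c = 0) : c ∈ C.stabZ := by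
  obtain ⟨s, hs, hsc⟩ := hU.exists_clean hc
  have hsZ : s ∈ C.stabZ := by
    refine Submodule.span_mono ?_ hs
    rintro _ ⟨i, rfl, _⟩
    exact ⟨i, rfl⟩
  have hsupp : ∀ q, q ∉ U ∪ T → s q = 0 := by
    intro q hq
    refine Submodule.span_induction (p := fun v _ => v q = 0) ?_ rfl ?_ ?_ hs
    · rintro _ ⟨i, rfl, p, hp, hip⟩
      by_contra hne
      exact hq (hZ i p hp hip q hne)
    · intro x y _ _ hx hy
      simp [hx, hy]
    · intro a x _ hx
      simp [hx]
  have hdiff : c - s ∈ C.stabZ := by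
    refine (hT (c - s) fun q hq => ?_).1 ?_
    · by_cases hqU : q ∈ U
      · simp [hsc q hqU]
      · have : q ∉ U ∪ T := by simp [hq, hqU]
        simp [hcs q this, hsupp q this]
    · rw [Matrix.mulVec_sub, hc, C.HX_mulVec_of_mem_stabZ hsZ, sub_zero]
  simpa using C.stabZ.add_mem hdiff hsZ

/-- Expansion: a correctable region can be enlarged by a correctable region that contains its
outer boundary. -/
theorem Correctable.union {C : CSSCode F RX RZ Q} {U T : Set Q} (hU : C.Correctable U)
    (hT : C.Correctable T)
    (hX : ∀ i, ∀ q ∈ U, C.HX i q ≠ 0 → ∀ q', C.HX i q' ≠ 0 → q' ∈ U ∪ T)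
    (hZ : ∀ i, ∀ q ∈ U, C.HZ i q ≠ 0 → ∀ q', C.HZ i q' ≠ 0 → q' ∈ U ∪ T) :
    C.Correctable (U ∪ T) := fun _ hcs =>
  ⟨fun hc => hU.union_aux hT hZ hcs hc, fun hc => hU.swap.union_aux hT.swap hX hcs hc⟩

/-- Cutting `c` along the cells keeps it in the kernel of `HX`: within `U` a row meets at most one
cell, so its pairing with a piece is either its pairing with `c` or zero. -/
theorem correctable_of_cells_aux {ι : Type*} {C : CSSCode F RX RZ Q} {U : Set Q} (cell : Q → ι)
    (h : ∀ z, C.Correctable (U ∩ {q | cell q = z}))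
    (hX : ∀ i, ∀ q ∈ U, ∀ q' ∈ U, C.HX i q ≠ 0 → C.HX i q' ≠ 0 → cell q = cell q')
    {c : Q → F} (hcs : ∀ q, q ∉ U → c q = 0) (hc : C.HX *ᵥ c = 0) : c ∈ C.stabZ := by
  classical
  have hsum : c = ∑ z ∈ Finset.univ.image cell, fun q => if cell q = z then c q else 0 := by
    ext q
    rw [Finset.sum_apply, Finset.sum_ite_eq, if_pos (Finset.mem_image_of_mem _ (Finset.mem_univ q))]
  rw [hsum]
  refine Submodule.sum_mem _ fun z _ => (h z _ fun q hq => ?_).1 ?_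
  · simp only [Set.mem_inter_iff, Set.mem_ofPred_eq, not_and] at hq
    by_cases hqU : q ∈ U
    · simp [hq hqU]
    · simp [hcs q hqU]
  · funext i
    by_cases hi : ∃ q ∈ U, C.HX i q ≠ 0 ∧ cell q = z
    · obtain ⟨p, hpU, hip, rfl⟩ := hi
      have := congrFun hc i
      rw [← this]
      refine Finset.sum_congr rfl fun q _ => ?_
      by_cases hq : C.HX i q = 0
      · simp [hq]
      · by_cases hqU : q ∈ U
        · simp [hX i q hqU p hpU hq hip]
        · simp [hcs q hqU]
    · push Not at hi
      refine Finset.sum_eq_zero fun q _ => ?_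
      by_cases hq : C.HX i q = 0
      · simp [hq]
      · by_cases hqU : q ∈ U
        · simp [hi q hqU hq]
        · simp [hcs q hqU]

/-- A region is correctable if it splits into correctable cells such that no generator meets two
of them. -/
theorem correctable_of_cells {ι : Type*} {C : CSSCode F RX RZ Q} {U : Set Q} (cell : Q → ι)
    (h : ∀ z, C.Correctable (U ∩ {q | cell q = z}))
    (hX : ∀ i, ∀ q ∈ U, ∀ q' ∈ U, C.HX i q ≠ 0 → C.HX i q' ≠ 0 → cell q = cell q')
    (hZ : ∀ i, ∀ q ∈ U, ∀ q' ∈ U, C.HZ i q ≠ 0 → C.HZ i q' ≠ 0 → cell q = cell q') :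
    C.Correctable U := fun _ hcs =>
  ⟨fun hc => correctable_of_cells_aux cell h hX hcs hc,
    fun hc => correctable_of_cells_aux (C := C.swap) cell (fun z => (h z).swap) hZ hcs hc⟩

/-- The number of logical qudits is the dimension of the space of words modulo stabilizers. -/
theorem numLogical_eq [Finite RZ] (C : CSSCode F RX RZ Q) :
    C.numLogical = Module.finrank F (LinearMap.ker C.HX.mulVecLin) - Module.finrank F C.stabZ := by
  have h1 : C.HZ.rank = Module.finrank F C.stabZ := Matrix.rank_eq_finrank_span_row _
  have h2 := LinearMap.finrank_range_add_finrank_ker C.HX.mulVecLin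
  have h3 : C.HX.rank = Module.finrank F (LinearMap.range C.HX.mulVecLin) := rfl
  rw [Module.finrank_fintype_fun_eq_card] at h2
  unfold numLogical
  omega

/-- If the qudits are covered by two correctable regions and a third one, the third one has at
least `k` elements. -/
theorem numLogical_le_ncard [Finite RZ] (C : CSSCode F RX RZ Q) {A B E : Set Q}
    (hA : C.Correctable A) (hB : C.Correctable B) (hcov : ∀ q, q ∈ A ∨ q ∈ B ∨ q ∈ E) :
    C.numLogical ≤ E.ncard := by
  classical
  rw [numLogical_eq]
  set K := LinearMap.ker C.HX.mulVecLin
  -- Cleaning on `A` gives every class a representative in `V`. A word in `V` that also vanishes on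
  -- `E` is supported in `B`, hence a stabilizer; so `k` is at most the rank of the restriction to
  -- `E`.
  let V : Submodule F (Q → F) := K ⊓ LinearMap.ker (restrictTo F A)
  let ρ : V →ₗ[F] (E → F) := (LinearMap.funLeft F F ((↑) : E → Q)) ∘ₗ V.subtype
  have hVA : ∀ c ∈ V, ∀ q ∈ A, c q = 0 := by
    intro c hc q hq
    have := congrFun (show restrictTo F A c = 0 from hc.2) q
    simpa [hq] using this
  have hker : (LinearMap.ker ρ).map V.subtype ≤ C.stabZ := by
    rintro _ ⟨c, hc, rfl⟩
    refine (hB _ fun q hq => ?_).1 c.2.1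
    rcases hcov q with h | h | h
    · exact hVA _ c.2 q h
    · exact absurd h hq
    · exact congrFun (show ρ c = 0 from hc) ⟨q, h⟩
  have hsup : K ≤ C.stabZ ⊔ V := by
    intro c hc
    obtain ⟨s, hs, hsc⟩ := hA.exists_clean (show C.HX *ᵥ c = 0 from hc)
    have hsZ : s ∈ C.stabZ := by
      refine Submodule.span_mono ?_ hs
      rintro _ ⟨i, rfl, _⟩
      exact ⟨i, rfl⟩
    refine Submodule.mem_sup.2 ⟨s, hsZ, c - s, ⟨?_, ?_⟩, by abel⟩
    · change C.HX *ᵥ (c - s) = 0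
      rw [Matrix.mulVec_sub, C.HX_mulVec_of_mem_stabZ hsZ, sub_zero]
      exact hc
    · change restrictTo F A (c - s) = 0
      ext q
      rw [restrictTo_apply, Set.indicator_apply, Pi.zero_apply]
      split_ifs with h
      · simp [hsc q h]
      · rfl
  have e1 := Submodule.finrank_sup_add_finrank_inf_eq C.stabZ V
  have e2 := Submodule.finrank_mono (hsup)
  have e3 := LinearMap.finrank_range_add_finrank_ker ρ
  have e4 : Module.finrank F (LinearMap.range ρ) ≤ E.ncard := by
    refine (Submodule.finrank_le _).trans ?_
    rw [Module.finrank_fintype_fun_eq_card, ← Nat.card_eq_fintype_card]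
    rfl
  have e5 : Module.finrank F (LinearMap.ker ρ) ≤ Module.finrank F ↥(C.stabZ ⊓ V) := by
    rw [← Submodule.finrank_map_subtype_eq]
    refine Submodule.finrank_mono (le_inf hker ?_)
    exact Submodule.map_subtype_le V _
  omega

/-! ### Invariance of the parameters under equivalence -/

/-- Relabelling of the qudits followed by a rescaling, as a linear equivalence. -/
def monomialEquiv (σ : Q ≃ Q') (u : Q → Fˣ) : (Q → F) ≃ₗ[F] (Q' → F) where
  toFun v := fun p => (u (σ.symm p) : F) * v (σ.symm p)
  map_add' x y := by
    ext p
    simp [mul_add]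
  map_smul' a x := by
    ext p
    simp [mul_left_comm]
  invFun v := fun q => (u q : F)⁻¹ * v (σ q)
  left_inv v := by
    ext q
    simp
  right_inv v := by
    ext p
    simp

theorem hammingNorm_monomialEquiv [DecidableEq F] (σ : Q ≃ Q') (u : Q → Fˣ) (v : Q → F) :
    hammingNorm (monomialEquiv σ u v) = hammingNorm v := by
  unfold hammingNorm
  refine (Finset.card_equiv σ fun q => ?_).symm
  simp [monomialEquiv]

/-- Inverse scalars on the two sides preserve the pairing; this is why an equivalence carries the
kernels of the check matrices along with the stabilizer spaces. -/
theorem monomialEquiv_dotProduct (σ : Q ≃ Q') (u : Q → Fˣ) (v c : Q → F) :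
    monomialEquiv σ u v ⬝ᵥ monomialEquiv σ u⁻¹ c = v ⬝ᵥ c := by
  unfold dotProduct
  refine (Fintype.sum_equiv σ _ _ fun q => ?_).symm
  simp only [monomialEquiv, LinearEquiv.coe_mk, LinearMap.coe_mk, AddHom.coe_mk,
    Equiv.symm_apply_apply, Pi.inv_apply, Units.val_inv_eq_inv_val]
  field_simp

theorem equivalent_iff (C : CSSCode F RX RZ Q) (C' : CSSCode F RX' RZ' Q') :
    C.Equivalent C' ↔ ∃ (σ : Q ≃ Q') (u : Q → Fˣ),
      (∀ v, v ∈ C.stabX ↔ monomialEquiv σ u v ∈ C'.stabX) ∧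
      (∀ v, v ∈ C.stabZ ↔ monomialEquiv σ u⁻¹ v ∈ C'.stabZ) := by
  unfold Equivalent
  simp [monomialEquiv]

theorem HX_mulVec_monomialEquiv {C : CSSCode F RX RZ Q} {C' : CSSCode F RX' RZ' Q'}
    {σ : Q ≃ Q'} {u : Q → Fˣ} (hX : ∀ v, v ∈ C.stabX ↔ monomialEquiv σ u v ∈ C'.stabX)
    (c : Q → F) : C'.HX *ᵥ monomialEquiv σ u⁻¹ c = 0 ↔ C.HX *ᵥ c = 0 := by
  rw [HX_mulVec_eq_zero_iff, HX_mulVec_eq_zero_iff]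
  constructor
  · intro h v hv
    rw [← monomialEquiv_dotProduct σ u]
    exact h _ ((hX v).1 hv)
  · intro h v hv
    obtain ⟨w, rfl⟩ := (monomialEquiv σ u).surjective v
    rw [monomialEquiv_dotProduct]
    exact h _ ((hX w).2 hv)

theorem finrank_eq_of_linearEquiv {V W : Type*} [AddCommGroup V] [Module F V] [AddCommGroup W]
    [Module F W] (e : V ≃ₗ[F] W) {S : Submodule F V} {T : Submodule F W}
    (h : ∀ v, v ∈ S ↔ e v ∈ T) : Module.finrank F S = Module.finrank F T := by
  have : T = S.map (e : V →ₗ[F] W) := by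
    ext w
    obtain ⟨v, rfl⟩ := e.surjective w
    rw [← h]
    simp
  rw [this]
  exact (LinearEquiv.finrank_map_eq e S).symm

theorem Equivalent.numLogical_eq [Finite RX] [Finite RZ] [Finite RX'] [Finite RZ']
    {C : CSSCode F RX RZ Q} {C' : CSSCode F RX' RZ' Q'} (h : C.Equivalent C') :
    C.numLogical = C'.numLogical := by
  obtain ⟨σ, u, hX, hZ⟩ := (equivalent_iff _ _).1 h
  unfold numLogical
  rw [Fintype.card_congr σ, Matrix.rank_eq_finrank_span_row, Matrix.rank_eq_finrank_span_row,
    Matrix.rank_eq_finrank_span_row, Matrix.rank_eq_finrank_span_row]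
  have h1 : Module.finrank F C.stabX = Module.finrank F C'.stabX := finrank_eq_of_linearEquiv _ hX
  have h2 : Module.finrank F C.stabZ = Module.finrank F C'.stabZ := finrank_eq_of_linearEquiv _ hZ
  unfold stabX at h1
  unfold stabZ at h2
  rw [h1, h2]

theorem Equivalent.distance_eq
    {C : CSSCode F RX RZ Q} {C' : CSSCode F RX' RZ' Q'} (h : C.Equivalent C') :
    C.distance = C'.distance := by
  classical
  obtain ⟨σ, u, hX, hZ⟩ := (equivalent_iff _ _).1 h
  unfold distance
  congr 1
  ext t
  simp only [Set.mem_image, nontrivialWords, Set.mem_union, Set.mem_ofPred_eq]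
  constructor
  · rintro ⟨c, ⟨hc, hs⟩ | ⟨hc, hs⟩, rfl⟩
    · exact ⟨monomialEquiv σ u⁻¹ c, Or.inl ⟨(HX_mulVec_monomialEquiv hX c).2 hc, by rwa [← hZ]⟩,
        by convert hammingNorm_monomialEquiv σ u⁻¹ c⟩
    · refine ⟨monomialEquiv σ u c, Or.inr ⟨?_, by rwa [← hX]⟩,
        by convert hammingNorm_monomialEquiv σ u c⟩
      have := (HX_mulVec_monomialEquiv (C := C.swap) (C' := C'.swap) (u := u⁻¹) hZ c).2 hc
      rwa [inv_inv] at this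
  · rintro ⟨c', ⟨hc, hs⟩ | ⟨hc, hs⟩, rfl⟩
    · obtain ⟨c, rfl⟩ := (monomialEquiv σ u⁻¹).surjective c'
      exact ⟨c, Or.inl ⟨(HX_mulVec_monomialEquiv hX c).1 hc, by rwa [hZ]⟩,
        by convert (hammingNorm_monomialEquiv σ u⁻¹ c).symm⟩
    · obtain ⟨c, rfl⟩ := (monomialEquiv σ u).surjective c'
      refine ⟨c, Or.inr ⟨?_, by rwa [hX]⟩, by convert (hammingNorm_monomialEquiv σ u c).symm⟩
      refine (HX_mulVec_monomialEquiv (C := C.swap) (C' := C'.swap) (u := u⁻¹) hZ c).1 ?_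
      rwa [inv_inv]

theorem IsLocal.mono {C : CSSCode F RX RZ Q} {D m r r' : ℕ} (h : C.IsLocal D m r) (hr : r ≤ r') :
    C.IsLocal D m r' := by
  obtain ⟨pos, hm, hX, hZ⟩ := h
  have hr' : (r : ℤ) ≤ r' := by exact_mod_cast hr
  exact ⟨pos, hm, fun i p p' h h' j => (hX i p p' h h' j).trans hr',
    fun i p p' h h' j => (hZ i p p' h h' j).trans hr'⟩

theorem mem_span_row_submatrix {R R' Q Q' : Type*} (e : R ≃ R') (σ : Q ≃ Q') (H : Matrix R Q F)
    (v : Q → F) : v ∈ Submodule.span F (Set.range H.row) ↔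
      (fun p => v (σ.symm p)) ∈ Submodule.span F (Set.range (H.submatrix e.symm σ.symm).row) := by
  let φ : (Q → F) ≃ₗ[F] (Q' → F) := LinearEquiv.funCongrLeft F F σ.symm
  have : Set.range (H.submatrix e.symm σ.symm).row = (φ : (Q → F) →ₗ[F] (Q' → F)) ''
      Set.range H.row := by
    ext w
    constructor
    · rintro ⟨i, rfl⟩
      exact ⟨_, ⟨e.symm i, rfl⟩, rfl⟩
    · rintro ⟨_, ⟨i, rfl⟩, rfl⟩
      refine ⟨e i, ?_⟩
      ext p
      simp [φ, Matrix.row, LinearEquiv.funCongrLeft, LinearMap.funLeft]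
  rw [this, Submodule.span_image]
  change _ ↔ (φ : (Q → F) →ₗ[F] (Q' → F)) v ∈ _
  constructor
  · exact fun h => Submodule.mem_map_of_mem h
  · rintro ⟨w, hw, hwv⟩
    rwa [← φ.injective hwv]

theorem IsLocal.equivalentToLocal [Finite RX] [Finite RZ] {C : CSSCode F RX RZ Q} {D m r : ℕ}
    (h : C.IsLocal D m r) : C.EquivalentToLocal D m r := by
  obtain ⟨s, ⟨eX⟩⟩ := Finite.exists_equiv_fin RX
  obtain ⟨t, ⟨eZ⟩⟩ := Finite.exists_equiv_fin RZ
  let σ := Fintype.equivFin Q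
  let C' : CSSCode F (Fin s) (Fin t) (Fin (Fintype.card Q)) :=
    { HX := C.HX.submatrix eX.symm σ.symm
      HZ := C.HZ.submatrix eZ.symm σ.symm
      orth := by
        rw [Matrix.transpose_submatrix, Matrix.submatrix_mul_equiv, C.orth, Matrix.submatrix_zero]
        rfl }
  refine ⟨s, t, C', ⟨σ, fun _ => 1, ?_, ?_⟩, ?_⟩
  · intro v
    simp only [Units.val_one, one_mul]
    exact mem_span_row_submatrix eX σ C.HX v
  · intro v
    simp only [Units.val_one, inv_one, one_mul]
    exact mem_span_row_submatrix eZ σ C.HZ v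
  · obtain ⟨pos, hm, hX, hZ⟩ := h
    refine ⟨pos ∘ σ.symm, fun x => ?_, fun i p p' => hX _ _ _, fun i p p' => hZ _ _ _⟩
    refine le_trans (le_of_eq ?_) (hm x)
    rw [← Set.ncard_image_of_injective _ σ.symm.injective]
    congr 1
    ext q
    simp

end CSSCode

/-! ### Counting in ℤ^D: cubes, shells, and windows under random shifts -/

/-- The cube of radius `ρ` around `x` in `ℤ^D`. -/
noncomputable def latticeCube {D : ℕ} (x : Fin D → ℤ) (ρ : ℕ) : Finset (Fin D → ℤ) :=
  Fintype.piFinset fun i => Finset.Icc (x i - ρ) (x i + ρ)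

theorem mem_latticeCube {D : ℕ} {x y : Fin D → ℤ} {ρ : ℕ} :
    y ∈ latticeCube x ρ ↔ ∀ i, |y i - x i| ≤ ρ := by
  simp only [latticeCube, Fintype.mem_piFinset, Finset.mem_Icc, abs_le]
  exact forall_congr' fun i => by constructor <;> intro h <;> constructor <;> omega

theorem card_latticeCube {D : ℕ} (x : Fin D → ℤ) (ρ : ℕ) :
    (latticeCube x ρ).card = (2 * ρ + 1) ^ D := by
  rw [latticeCube, Fintype.card_piFinset]
  have : ∀ i, (Finset.Icc (x i - ρ) (x i + ρ)).card = 2 * ρ + 1 := by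
    intro i
    rw [Int.card_Icc]
    omega
  simp [this]

theorem latticeCube_mono {D : ℕ} (x : Fin D → ℤ) {ρ ρ' : ℕ} (h : ρ ≤ ρ') :
    latticeCube x ρ ⊆ latticeCube x ρ' := by
  intro y hy
  rw [mem_latticeCube] at hy ⊢
  intro i
  have := hy i
  omega

/-- The mean value estimate for a power; it bounds the volume of a cubical shell. -/
theorem Nat.pow_le_pow_add_mul {a b : ℕ} (h : a ≤ b) (D : ℕ) :
    b ^ (D + 1) ≤ a ^ (D + 1) + (D + 1) * (b - a) * b ^ D := by
  induction D with
  | zero => simp; omega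
  | succ D ih =>
    obtain ⟨c, rfl⟩ := Nat.exists_eq_add_of_le h
    rw [Nat.add_sub_cancel_left] at ih ⊢
    have h1 : a ^ (D + 1) ≤ (a + c) ^ (D + 1) := Nat.pow_le_pow_left (by omega) _
    calc (a + c) ^ (D + 1 + 1) = a * (a + c) ^ (D + 1) + c * (a + c) ^ (D + 1) := by ring
      _ ≤ a * (a ^ (D + 1) + (D + 1) * c * (a + c) ^ D) + c * (a + c) ^ (D + 1) := by gcongr
      _ ≤ a ^ (D + 1 + 1) + (D + 1) * c * ((a + c) * (a + c) ^ D) + c * (a + c) ^ (D + 1) := by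
        have : a * (a + c) ^ D ≤ (a + c) * (a + c) ^ D := Nat.mul_le_mul_right _ (by omega)
        calc _ = a ^ (D + 1 + 1) + (D + 1) * c * (a * (a + c) ^ D) + c * (a + c) ^ (D + 1) := by ring
          _ ≤ _ := by gcongr
      _ = a ^ (D + 1 + 1) + (D + 1 + 1) * c * (a + c) ^ (D + 1) := by ring

theorem card_latticeCube_sdiff_le {D : ℕ} (x : Fin (D + 1) → ℤ) {ρ r : ℕ} (h : r ≤ ρ) :
    (latticeCube x ρ \ latticeCube x (ρ - r)).card ≤ (D + 1) * (2 * r) * (2 * ρ + 1) ^ D := by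
  rw [Finset.card_sdiff_of_subset (latticeCube_mono x (Nat.sub_le ρ r)), card_latticeCube,
    card_latticeCube]
  have := Nat.pow_le_pow_add_mul (a := 2 * (ρ - r) + 1) (b := 2 * ρ + 1) (by omega) D
  rw [show 2 * ρ + 1 - (2 * (ρ - r) + 1) = 2 * r by omega] at this
  omega

theorem card_window_le (x : ℤ) (R s : ℕ) (hR : 0 < R) :
    (Finset.univ.filter fun t : Fin R => (x + (t : ℕ)) % (R : ℤ) < s).card ≤ s := by
  rw [← Finset.card_range s]
  refine Finset.card_le_card_of_injOn (fun t => ((x + (t : ℕ)) % (R : ℤ)).toNat) ?_ ?_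
  · intro t ht
    have h1 : (x + (t : ℕ)) % (R : ℤ) < s := by simpa using ht
    have h2 := Int.emod_nonneg (x + (t : ℕ)) (show (R : ℤ) ≠ 0 by omega)
    simp only [Finset.coe_range, Set.mem_Iio]
    omega
  · intro t _ t' _ htt
    have h2 := Int.emod_nonneg (x + (t : ℕ)) (show (R : ℤ) ≠ 0 by omega)
    have h3 := Int.emod_nonneg (x + (t' : ℕ)) (show (R : ℤ) ≠ 0 by omega)
    have h4 : (x + (t : ℕ)) % (R : ℤ) = (x + (t' : ℕ)) % (R : ℤ) := by
      simp only at htt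
      omega
    have h5 : ((t : ℕ) : ℤ) % R = ((t' : ℕ) : ℤ) % R := Int.ModEq.add_left_cancel' x h4
    rw [Int.emod_eq_of_lt (by omega) (by omega), Int.emod_eq_of_lt (by omega) (by omega)] at h5
    exact Fin.ext (by exact_mod_cast h5)

/-- Were the quotients different, the larger number would lie at least `r` beyond a multiple of `R`
that the smaller one has not reached. -/
theorem Int.ediv_eq_of_abs_sub_le {x y R r : ℤ} (hR : 0 < R) (h : |x - y| ≤ r)
    (hx : r ≤ x % R) (hy : r ≤ y % R) : x / R = y / R := by
  have ex := Int.mul_ediv_add_emod x R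
  have ey := Int.mul_ediv_add_emod y R
  have lx := Int.emod_lt_of_pos x hR
  have ly := Int.emod_lt_of_pos y hR
  rw [abs_le] at h
  rcases lt_trichotomy (x / R) (y / R) with hlt | heq | hlt
  · nlinarith
  · exact heq
  · nlinarith

/-- Points in windows of length `r` at different multiples of `R` are more than `R - r > r` apart.
-/
theorem Int.ediv_eq_of_emod_lt {x y R r : ℤ} (hR : 2 * r < R) (h : |x - y| ≤ r) (hx : x % R < r)
    (hy : y % R < r) : x / R = y / R := by
  have h0 : 0 < R := by have := abs_nonneg (x - y); omega
  have ex := Int.mul_ediv_add_emod x R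
  have ey := Int.mul_ediv_add_emod y R
  have lx := Int.emod_nonneg x h0.ne'
  have ly := Int.emod_nonneg y h0.ne'
  rw [abs_le] at h
  rcases lt_trichotomy (x / R) (y / R) with hlt | heq | hlt
  · nlinarith
  · exact heq
  · nlinarith

/-- The window `[0, r)` widened by `r` on both sides becomes `[0, 3r)` after a shift by `r`; the
bound `3 * r ≤ R` excludes wrap-around. -/
theorem Int.add_emod_lt_of_emod_lt {x y R r : ℤ} (hR : 3 * r ≤ R) (h : |x - y| ≤ r)
    (hx : x % R < r) (h0 : 0 < R) : (y + r) % R < 3 * r := by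
  have ex := Int.mul_ediv_add_emod x R
  have lx := Int.emod_nonneg x h0.ne'
  rw [abs_le] at h
  have : (y + r) % R = (y + r - R * (x / R)) % R := by
    rw [Int.sub_mul_emod_self_left]
  rw [this, Int.emod_eq_of_lt (by omega) (by omega)]
  omega

/-- Shifts in two different coordinates are independent, and each hits its window with frequency at
most `s / R`. -/
theorem card_double_window_le {D : ℕ} (x : Fin D → ℤ) {R s : ℕ} (hR : 0 < R) {i j : Fin D}
    (hij : i ≠ j) :
    (Finset.univ.filter fun t : Fin D → Fin R => (x i + (t i : ℕ)) % (R : ℤ) < s ∧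
      (x j + (t j : ℕ)) % (R : ℤ) < s).card * R ^ 2 ≤ s ^ 2 * R ^ D := by
  classical
  let W : Fin D → Finset (Fin R) := fun l => if l = i ∨ l = j then
    Finset.univ.filter fun t : Fin R => (x l + (t : ℕ)) % (R : ℤ) < s else Finset.univ
  have hsub : (Finset.univ.filter fun t : Fin D → Fin R => (x i + (t i : ℕ)) % (R : ℤ) < s ∧
      (x j + (t j : ℕ)) % (R : ℤ) < s) ⊆ Fintype.piFinset W := by
    intro t ht
    simp only [Finset.mem_filter, Finset.mem_univ, true_and] at ht
    rw [Fintype.mem_piFinset]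
    intro l
    by_cases hl : l = i ∨ l = j
    · simp only [W, if_pos hl, Finset.mem_filter, Finset.mem_univ, true_and]
      rcases hl with rfl | rfl
      · exact ht.1
      · exact ht.2
    · simp [W, hl]
  have hji : j ∈ Finset.univ.erase i := by simp [hij.symm]
  have hcard : (Fintype.piFinset W).card = (W i).card * ((W j).card * R ^ (D - 2)) := by
    rw [Fintype.card_piFinset, ← Finset.mul_prod_erase _ _ (Finset.mem_univ i),
      ← Finset.mul_prod_erase _ _ hji]
    congr 2
    rw [Finset.prod_congr rfl (g := fun _ => R)]
    · rw [Finset.prod_const, Finset.card_erase_of_mem hji,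
        Finset.card_erase_of_mem (Finset.mem_univ i), Finset.card_univ, Fintype.card_fin]
      rfl
    · intro l hl
      simp only [Finset.mem_erase, Finset.mem_univ, and_true] at hl
      simp [W, hl.1, hl.2]
  have hi : (W i).card ≤ s := by
    simpa [W] using card_window_le (x i) R s hR
  have hj : (W j).card ≤ s := by
    simpa [W] using card_window_le (x j) R s hR
  have hD : D - 2 + 2 = D := by
    have := i.2
    have := j.2
    have := Fin.val_ne_of_ne hij
    omega
  calc _ ≤ (s * (s * R ^ (D - 2))) * R ^ 2 := by
        gcongr
        refine (Finset.card_le_card hsub).trans ?_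
        rw [hcard]
        gcongr
    _ = s ^ 2 * R ^ (D - 2 + 2) := by ring
    _ = s ^ 2 * R ^ D := by rw [hD]

/-! ### Trade-offs for codes placed in ℤ^D at a fixed length scale -/

namespace CSSCode

open Matrix

variable {F : Type*} [Field F] {RX RZ Q : Type*} [Fintype Q]

/-- `pos` places the qudits in `ℤ^D` with at most `m` qudits per site and generators of diameter
at most `r`. -/
structure IsPlacement (C : CSSCode F RX RZ Q) {D : ℕ} (m r : ℕ) (pos : Q → Fin D → ℤ) : Prop where
  ncard_le : ∀ x : Fin D → ℤ, Set.ncard {p | pos p = x} ≤ m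
  dist_X : ∀ (i : RX) (p p' : Q), C.HX i p ≠ 0 → C.HX i p' ≠ 0 → ∀ j, |pos p j - pos p' j| ≤ (r : ℤ)
  dist_Z : ∀ (i : RZ) (p p' : Q), C.HZ i p ≠ 0 → C.HZ i p' ≠ 0 → ∀ j, |pos p j - pos p' j| ≤ (r : ℤ)

namespace IsPlacement

variable {C : CSSCode F RX RZ Q} {D m r : ℕ}

theorem ncard_preimage_le {pos : Q → Fin D → ℤ} (h : C.IsPlacement m r pos)
    (S : Finset (Fin D → ℤ)) : {p | pos p ∈ S}.ncard ≤ m * S.card := by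
  classical
  have := Finset.card_le_mul_card_image_of_maps_to (s := Finset.univ.filter fun p => pos p ∈ S)
    (t := S) (f := pos) (fun p hp => (Finset.mem_filter.1 hp).2) m (fun x _ => by
      refine le_trans ?_ (h.ncard_le x)
      rw [← Set.ncard_coe_finset]
      refine Set.ncard_le_ncard (fun p hp => ?_) (Set.toFinite _)
      simp only [Finset.coe_filter, Finset.mem_filter, Set.mem_ofPred_eq] at hp
      exact hp.2)
  refine le_trans (le_of_eq ?_) this
  rw [← Set.ncard_coe_finset]
  congr 1
  ext p
  simp

/-- Cubes of small surface are correctable. -/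
theorem correctable_cube {pos : Q → Fin (D + 1) → ℤ} (h : C.IsPlacement m r pos) (hr : 1 ≤ r)
    (x : Fin (D + 1) → ℤ) (ρ : ℕ)
    (hd : m * ((D + 1) * (3 * r) * (2 * ρ + 1) ^ D) < C.distance) :
    C.Correctable {p | pos p ∈ latticeCube x ρ} := by
  induction ρ using Nat.strong_induction_on with
  | _ ρ ih =>
    -- The constant `3 * r` serves both cases: a cube of radius at most `r` has side `2 * ρ + 1 ≤ 3
    -- * r` and is itself small; for a larger one the shell of width `r` needs only `2 * r`.
    by_cases hρ : ρ ≤ r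
    · refine C.correctable_of_ncard_lt (lt_of_le_of_lt ?_ hd)
      refine (h.ncard_preimage_le _).trans (Nat.mul_le_mul_left m ?_)
      rw [card_latticeCube, pow_succ, mul_comm]
      refine Nat.mul_le_mul_right _ ?_
      nlinarith
    · have hlt : ρ - r < ρ := by omega
      have hU := ih (ρ - r) hlt (lt_of_le_of_lt (by gcongr) hd)
      have hT : C.Correctable {p | pos p ∈ latticeCube x ρ \ latticeCube x (ρ - r)} := by
        refine C.correctable_of_ncard_lt (lt_of_le_of_lt ?_ hd)
        refine (h.ncard_preimage_le _).trans (Nat.mul_le_mul_left m ?_)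
        refine (card_latticeCube_sdiff_le x (by omega)).trans ?_
        gcongr
        omega
      have hUT : {p | pos p ∈ latticeCube x ρ} = {p | pos p ∈ latticeCube x (ρ - r)} ∪
          {p | pos p ∈ latticeCube x ρ \ latticeCube x (ρ - r)} := by
        ext p
        have := @latticeCube_mono _ x (ρ - r) ρ (by omega) (pos p)
        simp only [Set.mem_ofPred_eq, Set.mem_union, Finset.mem_sdiff]
        tauto
      have step : ∀ p p' : Q, pos p ∈ latticeCube x (ρ - r) →
          (∀ j, |pos p j - pos p' j| ≤ (r : ℤ)) → pos p' ∈ latticeCube x ρ := by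
        intro p p' hp hpp
        rw [mem_latticeCube] at hp ⊢
        intro j
        have h1 := hp j
        have h2 := hpp j
        rw [abs_le] at *
        omega
      rw [hUT]
      refine hU.union hT ?_ ?_
      · intro i q hq hiq q' hiq'
        rw [← hUT]
        exact step q q' hq (h.dist_X i q q' hiq hiq')
      · intro i q hq hiq q' hiq'
        rw [← hUT]
        exact step q q' hq (h.dist_Z i q q' hiq hiq')

/-- A region is correctable if generators do not connect different cells of a partition of the
space into cubes of small surface. -/
theorem correctable_of_grid {pos : Q → Fin (D + 1) → ℤ} (h : C.IsPlacement m r pos) (hr : 1 ≤ r)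
    {R : ℕ} (hR : 0 < R) (hd : m * ((D + 1) * (3 * r) * (2 * R + 1) ^ D) < C.distance)
    (t : Fin (D + 1) → ℤ) {U : Set Q}
    (hU : ∀ p ∈ U, ∀ p' ∈ U, (∀ j, |pos p j - pos p' j| ≤ (r : ℤ)) →
      ∀ j, (pos p j + t j) / R = (pos p' j + t j) / R) : C.Correctable U := by
  refine correctable_of_cells (fun p j => (pos p j + t j) / (R : ℤ)) ?_ ?_ ?_
  · intro z
    -- A cell is a box of side `R` with lower corner `R * z - t`, contained in the cube of radius
    -- `R` around that corner.
    refine (h.correctable_cube hr (fun j => R * z j - t j) R hd).mono ?_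
    rintro p ⟨_, hp⟩
    change pos p ∈ latticeCube _ _
    rw [mem_latticeCube]
    intro j
    have h1 : (pos p j + t j) / (R : ℤ) = z j := congrFun hp j
    have h2 := Int.mul_ediv_add_emod (pos p j + t j) R
    have h3 := Int.emod_nonneg (pos p j + t j) (show (R : ℤ) ≠ 0 by omega)
    have h4 := Int.emod_lt_of_pos (pos p j + t j) (show (0 : ℤ) < R by omega)
    rw [h1] at h2
    rw [abs_le]
    constructor <;> linarith
  · intro i q hq q' hq' h1 h2
    exact funext (hU q hq q' hq' (h.dist_X i q q' h1 h2))
  · intro i q hq q' hq' h1 h2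
    exact funext (hU q hq q' hq' (h.dist_Z i q q' h1 h2))

theorem correctable_off_walls {pos : Q → Fin (D + 1) → ℤ} (h : C.IsPlacement m r pos) (hr : 1 ≤ r)
    {R : ℕ} (hR : 0 < R) (hd : m * ((D + 1) * (3 * r) * (2 * R + 1) ^ D) < C.distance)
    (t : Fin (D + 1) → ℤ) : C.Correctable {p | ∀ j, (r : ℤ) ≤ (pos p j + t j) % R} := by
  refine h.correctable_of_grid hr hR hd t fun p hp p' hp' hpp j => ?_
  refine Int.ediv_eq_of_abs_sub_le (by omega) ?_ (hp j) (hp' j)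
  simpa using hpp j

/-- For every shift the walls hold at least `d` qudits: fewer would be correctable, and adding them
to the cells would force `k = 0`. A qudit lies in a wall of given direction for at most `r` of the
`R` diagonal shifts; averaging gives the bound. -/
theorem distance_mul_le [Finite RZ] {pos : Q → Fin (D + 1) → ℤ} (h : C.IsPlacement m r pos)
    (hr : 1 ≤ r) {R : ℕ} (hR : 0 < R)
    (hd : m * ((D + 1) * (3 * r) * (2 * R + 1) ^ D) < C.distance) (hk : 0 < C.numLogical) :
    C.distance * R ≤ (D + 1) * r * Fintype.card Q := by
  classical
  have key : ∀ t : Fin R, C.distance ≤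
      (Finset.univ.filter fun p => ∃ j, (pos p j + (t : ℕ)) % (R : ℤ) < r).card := by
    intro t
    by_contra! hlt
    rw [← Set.ncard_coe_finset] at hlt
    have hA := h.correctable_off_walls hr hR hd (fun _ => (t : ℕ))
    have hS := C.correctable_of_ncard_lt hlt
    have hcov : ∀ q, q ∈ {p | ∀ j, (r : ℤ) ≤ (pos p j + (t : ℕ)) % (R : ℤ)} ∪
        ((Finset.univ.filter fun p => ∃ j, (pos p j + (t : ℕ)) % (R : ℤ) < r : Finset Q) :
          Set Q) := by
      intro q
      by_cases hq : ∃ j, (pos q j + (t : ℕ)) % (R : ℤ) < r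
      · right
        simpa using hq
      · left
        push Not at hq
        exact hq
    have hall := hA.union hS (fun _ _ _ _ q' _ => hcov q') (fun _ _ _ _ q' _ => hcov q')
    have := C.numLogical_le_ncard hall hall (E := ∅) (fun q => Or.inl (hcov q))
    rw [Set.ncard_empty] at this
    omega
  calc C.distance * R = ∑ _t : Fin R, C.distance := by simp [mul_comm]
    _ ≤ ∑ t : Fin R, (Finset.univ.filter fun p => ∃ j,
        (pos p j + (t : ℕ)) % (R : ℤ) < r).card := Finset.sum_le_sum fun t _ => key t
    _ ≤ ∑ t : Fin R, ∑ j, (Finset.univ.filter fun p =>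
        (pos p j + (t : ℕ)) % (R : ℤ) < r).card := by
      refine Finset.sum_le_sum fun t _ => ?_
      refine le_trans (Finset.card_le_card ?_) Finset.card_biUnion_le
      intro p hp
      simpa using hp
    _ = ∑ j, ∑ p, (Finset.univ.filter fun t : Fin R =>
        (pos p j + (t : ℕ)) % (R : ℤ) < r).card := by
      rw [Finset.sum_comm]
      refine Finset.sum_congr rfl fun j _ => ?_
      simp only [Finset.card_filter]
      rw [Finset.sum_comm]
    _ ≤ ∑ _j : Fin (D + 1), ∑ _p : Q, r :=
      Finset.sum_le_sum fun j _ => Finset.sum_le_sum fun p _ => card_window_le _ _ _ hR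
    _ = (D + 1) * r * Fintype.card Q := by
      simp
      ring

/-- The part of the walls away from the codimension-two skeleton is correctable. -/
theorem correctable_walls {pos : Q → Fin (D + 1) → ℤ} (h : C.IsPlacement m r pos) (hr : 1 ≤ r)
    {R : ℕ} (hR : 3 * r ≤ R) (hd : m * ((D + 1) * (3 * r) * (2 * R + 1) ^ D) < C.distance)
    (t : Fin (D + 1) → ℤ) :
    C.Correctable {p | ∃ i, (pos p i + t i) % R < r ∧
      ∀ j, j ≠ i → ¬ (pos p j + t j + r) % R < 3 * r} := by
  have hR0 : (0 : ℤ) < R := by omega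
  refine h.correctable_of_grid hr (by omega) hd t fun p hp p' hp' hpp j => ?_
  obtain ⟨i, hi, hp⟩ := hp
  obtain ⟨i', hi', hp'⟩ := hp'
  have hpp' : ∀ l, |pos p l + t l - (pos p' l + t l)| ≤ (r : ℤ) := by simpa using hpp
  have hpp'' : ∀ l, |pos p' l + t l - (pos p l + t l)| ≤ (r : ℤ) := fun l => by
    rw [abs_sub_comm]
    exact hpp' l
  -- Nearby points lie in walls of the same direction; otherwise `p` would also lie in the widened
  -- wall of direction `i'`, which has been excluded.
  have hii : i = i' := by
    by_contra hne
    exact hp i' (Ne.symm hne)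
      (Int.add_emod_lt_of_emod_lt (by omega) (hpp'' i') hi' hR0)
  subst hii
  by_cases hj : j = i
  · subst hj
    exact Int.ediv_eq_of_emod_lt (by omega) (hpp' j) hi hi'
  · refine Int.ediv_eq_of_abs_sub_le hR0 (hpp' j) ?_ ?_
    · by_contra! hlt
      exact hp j hj (Int.add_emod_lt_of_emod_lt (by omega) (by simp) hlt hR0)
    · by_contra! hlt
      exact hp' j hj (Int.add_emod_lt_of_emod_lt (by omega) (by simp) hlt hR0)

/-- Cells and trimmed walls are correctable, so `k` is at most the number of qudits in two widened
walls of different directions. The axes are shifted independently, so for each pair of directions a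
qudit is there for a fraction of at most `(3 * r / R) ^ 2` of the shifts. -/
theorem numLogical_mul_le [Finite RZ] {pos : Q → Fin (D + 1) → ℤ} (h : C.IsPlacement m r pos)
    (hr : 1 ≤ r) {R : ℕ} (hR : 3 * r ≤ R)
    (hd : m * ((D + 1) * (3 * r) * (2 * R + 1) ^ D) < C.distance) :
    C.numLogical * R ^ 2 ≤ ((D + 1) * (3 * r)) ^ 2 * Fintype.card Q := by
  classical
  have hR0 : 0 < R := by omega
  let P : Q → Fin (D + 1) → Fin (D + 1) → (Fin (D + 1) → Fin R) → Prop := fun p i j t =>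
    (pos p i + r + (t i : ℕ)) % (R : ℤ) < (3 * r : ℕ) ∧
      (pos p j + r + (t j : ℕ)) % (R : ℤ) < (3 * r : ℕ)
  let I : Finset (Fin (D + 1) × Fin (D + 1)) := Finset.univ.filter fun ij => ij.1 ≠ ij.2
  have key : ∀ t : Fin (D + 1) → Fin R, C.numLogical ≤
      ∑ ij ∈ I, (Finset.univ.filter fun p => P p ij.1 ij.2 t).card := by
    intro t
    have hA := h.correctable_off_walls hr hR0 hd (fun l => (t l : ℕ))
    have hB := h.correctable_walls hr hR hd (fun l => (t l : ℕ))
    have := C.numLogical_le_ncard hA hB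
      (E := (I.biUnion fun ij => Finset.univ.filter fun p => P p ij.1 ij.2 t : Finset Q)) ?_
    · rw [Set.ncard_coe_finset] at this
      exact this.trans Finset.card_biUnion_le
    · intro q
      by_cases h1 : ∀ l, (r : ℤ) ≤ (pos q l + (t l : ℕ)) % (R : ℤ)
      · exact Or.inl h1
      · push Not at h1
        obtain ⟨i, hi⟩ := h1
        right
        by_cases h2 : ∀ j, j ≠ i → ¬ (pos q j + (t j : ℕ) + r) % (R : ℤ) < 3 * r
        · exact Or.inl ⟨i, hi, h2⟩
        · push Not at h2
          obtain ⟨j, hji, hj⟩ := h2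
          right
          have hi' := Int.add_emod_lt_of_emod_lt (y := pos q i + (t i : ℕ)) (r := r) (R := R)
            (by omega) (by simp) hi (by omega)
          simp only [Finset.coe_biUnion, Set.mem_iUnion, Finset.coe_filter, Set.mem_ofPred_eq,
            Finset.mem_univ, true_and]
          refine ⟨(i, j), by simp [I, hji.symm], ?_, ?_⟩
          · rw [add_right_comm]
            exact_mod_cast hi'
          · rw [add_right_comm]
            exact_mod_cast hj
  have hsum : R ^ (D + 1) * C.numLogical ≤
      ∑ ij ∈ I, ∑ p, (Finset.univ.filter fun t => P p ij.1 ij.2 t).card := by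
    calc R ^ (D + 1) * C.numLogical = ∑ _t : Fin (D + 1) → Fin R, C.numLogical := by simp
      _ ≤ ∑ t : Fin (D + 1) → Fin R, ∑ ij ∈ I,
          (Finset.univ.filter fun p => P p ij.1 ij.2 t).card := Finset.sum_le_sum fun t _ => key t
      _ = _ := by
        rw [Finset.sum_comm]
        refine Finset.sum_congr rfl fun ij _ => ?_
        simp only [Finset.card_filter]
        rw [Finset.sum_comm]
  have hI : I.card ≤ (D + 1) ^ 2 := by
    refine (Finset.card_le_univ I).trans ?_
    simp [sq]
  refine Nat.le_of_mul_le_mul_left (c := R ^ (D + 1)) ?_ (by positivity)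
  calc R ^ (D + 1) * (C.numLogical * R ^ 2) = R ^ (D + 1) * C.numLogical * R ^ 2 := by ring
    _ ≤ (∑ ij ∈ I, ∑ p, (Finset.univ.filter fun t => P p ij.1 ij.2 t).card) * R ^ 2 := by gcongr
    _ = ∑ ij ∈ I, ∑ p, (Finset.univ.filter fun t => P p ij.1 ij.2 t).card * R ^ 2 := by
      simp only [Finset.sum_mul]
    _ ≤ ∑ ij ∈ I, ∑ _p : Q, (3 * r) ^ 2 * R ^ (D + 1) := by
      refine Finset.sum_le_sum fun ij hij => Finset.sum_le_sum fun p _ => ?_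
      exact card_double_window_le (fun l => pos p l + r) hR0 (Finset.mem_filter.1 hij).2
    _ = I.card * (Fintype.card Q * ((3 * r) ^ 2 * R ^ (D + 1))) := by simp
    _ ≤ (D + 1) ^ 2 * (Fintype.card Q * ((3 * r) ^ 2 * R ^ (D + 1))) := by gcongr
    _ = _ := by ring

end IsPlacement

end CSSCode

/-! ### From inequalities at each scale to power laws -/

/-- The trade-off inequalities for all admissible length scales `R` give bounds by powers. -/
theorem exists_power_bounds (D c b R₀ : ℕ) (hc : 1 ≤ c) (hR₀ : 1 ≤ R₀) :
    ∃ K : ℝ, 0 ≤ K ∧ ∀ n k d : ℕ, 1 ≤ n → k ≤ n →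
      (∀ R : ℕ, R₀ ≤ R → c * R ^ D < d → d * R ≤ b * n ∧ k * R ^ 2 ≤ b * n) →
      (d : ℝ) ≤ K * (n : ℝ) ^ (1 - 1 / ((D + 1 : ℕ) : ℝ)) ∧
      (2 ≤ D + 1 → (k : ℝ) * (d : ℝ) ^ (2 / (((D + 1 : ℕ) : ℝ) - 1)) ≤ K * n) := by
  rcases Nat.eq_zero_or_pos D with rfl | hD
  · refine ⟨c, by positivity, fun n k d hn hk h => ⟨?_, fun h2 => by omega⟩⟩
    -- Here the condition on `R` has no upper limit: `d > c` would give `d * R ≤ b * n` for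
    -- arbitrarily large `R`.
    have : d ≤ c := by
      by_contra! hlt
      have := (h (R₀ + b * n + 1) (by omega) (by simpa using hlt)).1
      have h1 : 1 * (R₀ + b * n + 1) ≤ d * (R₀ + b * n + 1) := Nat.mul_le_mul_right _ (by omega)
      omega
    simpa using this
  · have hD' : (0 : ℝ) < D := by exact_mod_cast hD
    set e : ℝ := 1 / D with he
    have he0 : 0 < e := by positivity
    set A : ℝ := 2 * c * (R₀ : ℝ) ^ D with hA
    set α : ℝ := 1 - 1 / ((D + 1 : ℕ) : ℝ) with hα
    have hα0 : 0 ≤ α := by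
      rw [hα, sub_nonneg, div_le_one (by positivity)]
      push_cast
      linarith
    have hαe : (1 + e) * α = 1 := by
      rw [he, hα]
      push_cast
      field_simp
      ring
    have h2e : 2 / (((D + 1 : ℕ) : ℝ) - 1) = e * 2 := by
      rw [he]
      push_cast
      rw [add_sub_cancel_right]
      ring
    have hc0 : (0 : ℝ) < 2 * c := by
      have : (0 : ℝ) < c := by exact_mod_cast hc
      linarith
    have hA0 : 0 ≤ A := by positivity
    set K₂ : ℝ := A ^ (e * 2)
    set K₃ : ℝ := (2 * b * (2 * c) ^ e) ^ α
    set K₄ : ℝ := 4 * b * ((2 * c : ℝ) ^ e) ^ 2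
    have hK₂ : 0 ≤ K₂ := by positivity
    have hK₃ : 0 ≤ K₃ := by positivity
    have hK₄ : 0 ≤ K₄ := by positivity
    rw [h2e]
    refine ⟨A + K₂ + K₃ + K₄, by positivity, fun n k d hn hk h => ?_⟩
    have hn1 : (1 : ℝ) ≤ n := by exact_mod_cast hn
    have hnα : 1 ≤ (n : ℝ) ^ α := Real.one_le_rpow hn1 hα0
    have hd0 : (0 : ℝ) ≤ d := by positivity
    have hk0 : (0 : ℝ) ≤ k := by positivity
    have hkn : (k : ℝ) ≤ n := by exact_mod_cast hk
    -- The critical scale, with `c * y ^ D = d / 2`; the factor two makes `c * R ^ D < d` strict for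
    -- `R = ⌊y⌋`. If `y < R₀`, then `d` is bounded by a constant and `k ≤ n` suffices.
    set y : ℝ := ((d : ℝ) / (2 * c)) ^ e with hy
    have hy0 : 0 ≤ y := by positivity
    have hyD : y ^ D = d / (2 * c) := by
      rw [hy, ← Real.rpow_natCast, ← Real.rpow_mul (by positivity), he,
        one_div_mul_cancel hD'.ne', Real.rpow_one]
    have hyd : y * (2 * c) ^ e = (d : ℝ) ^ e := by
      rw [hy, ← Real.mul_rpow (by positivity) hc0.le, div_mul_cancel₀ _ hc0.ne']
    rcases lt_or_ge y R₀ with hlt | hge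
    · have hdA : (d : ℝ) ≤ A := by
        have := pow_le_pow_left₀ hy0 hlt.le D
        rw [hyD, div_le_iff₀ hc0] at this
        rw [hA]
        linarith
      constructor
      · calc (d : ℝ) ≤ A * 1 := by simpa using hdA
          _ ≤ A * (n : ℝ) ^ α := by gcongr
          _ ≤ _ := by gcongr; linarith
      · intro _
        calc (k : ℝ) * (d : ℝ) ^ (e * 2) ≤ n * K₂ :=
              mul_le_mul hkn (Real.rpow_le_rpow hd0 hdA (by positivity)) (by positivity) (by positivity)
          _ = K₂ * n := mul_comm _ _
          _ ≤ _ := by gcongr; linarith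
    · set R := ⌊y⌋₊ with hR
      have hy1 : 1 ≤ y := le_trans (by exact_mod_cast hR₀) hge
      have hRR : R₀ ≤ R := Nat.le_floor hge
      have hRy : (R : ℝ) ≤ y := Nat.floor_le hy0
      have hyR : y ≤ 2 * R := by
        have h1 := Nat.lt_floor_add_one y
        have h2 : (1 : ℝ) ≤ R := by exact_mod_cast hR₀.trans hRR
        linarith
      have hdpos : (0 : ℝ) < d := by
        have : 0 < y ^ D := by positivity
        rw [hyD] at this
        rcases hd0.lt_or_eq with h | h
        · exact h
        · rw [← h] at this
          simp at this
      have hcR : c * R ^ D < d := by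
        have : (c : ℝ) * R ^ D < d := by
          calc (c : ℝ) * R ^ D ≤ c * y ^ D := by gcongr
            _ = d / 2 := by rw [hyD]; field_simp
            _ < d := by linarith
        exact_mod_cast this
      obtain ⟨h1, h2⟩ := h R hRR hcR
      have h1' : (d : ℝ) * R ≤ b * n := by exact_mod_cast h1
      have h2' : (k : ℝ) * (R : ℝ) ^ 2 ≤ b * n := by exact_mod_cast h2
      constructor
      · have h3 : (d : ℝ) ^ (1 + e) ≤ 2 * b * (2 * c) ^ e * n := by
          rw [Real.rpow_add hdpos, Real.rpow_one, ← hyd]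
          calc (d : ℝ) * (y * (2 * c) ^ e) ≤ d * (2 * R * (2 * c) ^ e) := by gcongr
            _ = 2 * (2 * c) ^ e * (d * R) := by ring
            _ ≤ 2 * (2 * c) ^ e * (b * n) := by gcongr
            _ = _ := by ring
        calc (d : ℝ) = ((d : ℝ) ^ (1 + e)) ^ α := by
              rw [← Real.rpow_mul hd0, hαe, Real.rpow_one]
          _ ≤ (2 * b * (2 * c) ^ e * n) ^ α := by gcongr
          _ = K₃ * (n : ℝ) ^ α := Real.mul_rpow (by positivity) (by positivity)
          _ ≤ _ := by gcongr; linarith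
      · intro _
        calc (k : ℝ) * (d : ℝ) ^ (e * 2) = k * (y * (2 * c) ^ e) ^ 2 := by
              rw [hyd, Real.rpow_mul hd0, Real.rpow_two]
          _ ≤ k * (2 * R * (2 * c) ^ e) ^ 2 := by gcongr
          _ = 4 * ((2 * c : ℝ) ^ e) ^ 2 * (k * (R : ℝ) ^ 2) := by ring
          _ ≤ 4 * ((2 * c : ℝ) ^ e) ^ 2 * (b * n) := by gcongr
          _ = K₄ * n := by ring
          _ ≤ _ := by gcongr; linarith

/-- Parameter bounds for CSS codes that are local in `D` dimensions. -/
theorem CSSCode.exists_local_bounds (D m r : ℕ) (hD : 1 ≤ D) :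
    ∃ K : ℝ, 0 ≤ K ∧ ∀ (F : Type*) [Field F] (RX RZ Q : Type) [Finite RZ] [Fintype Q]
      (C : CSSCode F RX RZ Q), C.IsLocal D m r → 0 < C.numLogical →
      (C.distance : ℝ) ≤ K * (Fintype.card Q : ℝ) ^ (1 - 1 / (D : ℝ)) ∧
      (2 ≤ D → (C.numLogical : ℝ) * (C.distance : ℝ) ^ (2 / ((D : ℝ) - 1)) ≤
        K * Fintype.card Q) := by
  obtain ⟨D, rfl⟩ := Nat.exists_eq_add_of_le' hD
  set s := max r 1 with hs
  -- `3 ^ D` absorbs `2 * R + 1 ≤ 3 * R`, the summand `1` makes the constant positive, and the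
  -- square dominates the coefficients of both trade-offs.
  obtain ⟨K, hK, h⟩ := exists_power_bounds D (m * ((D + 1) * (3 * s) * 3 ^ D) + 1)
    (((D + 1) * (3 * s)) ^ 2) (3 * s) (by omega) (by omega)
  refine ⟨K, hK, fun F _ RX RZ Q _ _ C hC hk => ?_⟩
  obtain ⟨pos, hm, hX, hZ⟩ := hC.mono (le_max_left r 1)
  have hp : C.IsPlacement m s pos := ⟨hm, hX, hZ⟩
  have hkn : C.numLogical ≤ Fintype.card Q := by
    unfold CSSCode.numLogical
    omega
  refine h (Fintype.card Q) C.numLogical C.distance (by omega) hkn fun R hR hd => ?_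
  have hR1 : 1 ≤ R := by omega
  have hd' : m * ((D + 1) * (3 * s) * (2 * R + 1) ^ D) < C.distance := by
    refine lt_of_le_of_lt ?_ hd
    calc m * ((D + 1) * (3 * s) * (2 * R + 1) ^ D) ≤ m * ((D + 1) * (3 * s) * (3 * R) ^ D) := by
          gcongr
          omega
      _ = m * ((D + 1) * (3 * s) * 3 ^ D) * R ^ D := by rw [mul_pow]; ring
      _ ≤ _ := by gcongr; omega
  refine ⟨(hp.distance_mul_le (by omega) (by omega) hd' hk).trans ?_,
    hp.numLogical_mul_le (by omega) hR hd'⟩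
  gcongr
  have h1 : (D + 1) * s ≤ (D + 1) * (3 * s) := by gcongr; omega
  have h2 : 1 ≤ (D + 1) * (3 * s) := Nat.mul_pos (by omega) (by omega)
  nlinarith

theorem GB.exists_parameterBounds (D m r : ℕ) (hD : 1 ≤ D) :
    ∃ K : ℝ, 0 ≤ K ∧ ∀ (F : Type*) [Field F] (ℓ : ℕ) [NeZero ℓ] (a b : Polynomial F),
      (GB.code ℓ a b).EquivalentToLocal D m r →
      0 < (GB.code ℓ a b).numLogical → GB.ParameterBounds ℓ a b D K := by
  obtain ⟨K, hK, h⟩ := CSSCode.exists_local_bounds D m r hD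
  refine ⟨K, hK, fun F _ ℓ _ a b ⟨s, t, C', hE, hC'⟩ hk => ?_⟩
  have := h F (Fin s) (Fin t) _ C' hC' (by rwa [← hE.numLogical_eq])
  have hcard : Fintype.card (ZMod ℓ ⊕ ZMod ℓ) = 2 * ℓ := by
    rw [Fintype.card_sum, ZMod.card]
    ring
  rw [← hE.numLogical_eq, ← hE.distance_eq, Fintype.card_fin, hcard] at this
  push_cast at this
  exact this

/-! ### Geometry of numbers: reduced bases of sublattices of ℤ^N -/

/-- Simultaneous Diophantine approximation. -/
theorem exists_simultaneous_approximation {N : ℕ} (t : Fin N → ℝ) {Q : ℕ} (hQ : 1 ≤ Q) :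
    ∃ q : ℕ, 1 ≤ q ∧ q ≤ Q ^ N ∧ ∃ n : Fin N → ℤ, ∀ i, |q * t i - n i| < 1 / Q := by
  have hQ0 : (0 : ℝ) < Q := by exact_mod_cast hQ
  -- Pigeonhole: `Q ^ N + 1` multiples of `t` modulo one fall into `Q ^ N` boxes of side `1 / Q`.
  let box : ℕ → Fin N → ℤ := fun j i => ⌊Q * Int.fract (j * t i)⌋
  have hmaps : Set.MapsTo box (Finset.range (Q ^ N + 1) : Set ℕ)
      (Fintype.piFinset fun _ : Fin N => Finset.Ico (0 : ℤ) Q : Finset (Fin N → ℤ)) := by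
    intro j _
    rw [Finset.mem_coe, Fintype.mem_piFinset]
    intro i
    rw [Finset.mem_Ico]
    have h0 := Int.fract_nonneg (j * t i)
    have h1 := Int.fract_lt_one (j * t i)
    refine ⟨Int.floor_nonneg.2 (by positivity), Int.floor_lt.2 ?_⟩
    push_cast
    nlinarith
  obtain ⟨j, hj, j', hj', hne, heq⟩ :=
    Finset.exists_ne_map_eq_of_card_lt_of_maps_to (by simp) hmaps
  wlog hlt : j < j' generalizing j j'
  · exact this j' hj' j hj hne.symm heq.symm (by omega)
  rw [Finset.mem_range] at hj hj'
  refine ⟨j' - j, by omega, by omega, fun i => ⌊j' * t i⌋ - ⌊j * t i⌋, fun i => ?_⟩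
  have h1 := Int.abs_sub_lt_one_of_floor_eq_floor (congrFun heq i).symm
  rw [← mul_sub, abs_mul, abs_of_pos hQ0, mul_comm, ← lt_div_iff₀ hQ0] at h1
  refine lt_of_eq_of_lt (congrArg abs ?_) h1
  rw [Nat.cast_sub hlt.le, Int.fract, Int.fract]
  push_cast
  ring

/-- Integer vectors as real vectors. -/
def castVec {N : ℕ} : (Fin N → ℤ) →+ (Fin N → ℝ) := (Int.castAddHom ℝ).compLeft (Fin N)

theorem castVec_apply {N : ℕ} (z : Fin N → ℤ) (i : Fin N) : castVec z i = z i := rfl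

theorem castVec_zsmul {N : ℕ} (k : ℤ) (z : Fin N → ℤ) : castVec (k • z) = (k : ℝ) • castVec z := by
  ext i
  simp [castVec_apply]

theorem castVec_injective {N : ℕ} : Function.Injective (castVec (N := N)) := by
  intro x y h
  ext i
  have := congrFun h i
  rw [castVec_apply, castVec_apply] at this
  exact_mod_cast this

/-- The sup-norm of an integer vector. -/
def supNatAbs {N : ℕ} (z : Fin N → ℤ) : ℕ := Finset.univ.sup fun i => (z i).natAbs

theorem norm_castVec {N : ℕ} (z : Fin N → ℤ) : ‖castVec z‖ = supNatAbs z := by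
  have habs : ∀ i, ‖castVec z i‖ = ((z i).natAbs : ℝ) := fun i => by
    rw [castVec_apply, Real.norm_eq_abs, Nat.cast_natAbs, Int.cast_abs]
  apply le_antisymm
  · refine (pi_norm_le_iff_of_nonneg (by positivity)).2 fun i => ?_
    rw [habs]
    exact_mod_cast Finset.le_sup (f := fun i => (z i).natAbs) (Finset.mem_univ i)
  · rw [← Nat.le_floor_iff (norm_nonneg _)]
    refine Finset.sup_le fun i _ => Nat.le_floor ?_
    rw [← habs]
    exact norm_le_pi_norm _ i

/-- Among independent `N`-tuples in `Λ`, take one with the least sum of sup-norms. A lattice vector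
with non-zero `i`-th coordinate could replace the `i`-th member, so it is not shorter. The tuple
need not generate `Λ`. -/
theorem exists_reduced_basis {N : ℕ} (Λ : AddSubgroup (Fin N → ℤ)) {k : ℤ} (hk : k ≠ 0)
    (hΛ : ∀ z, k • z ∈ Λ) :
    ∃ (b : Module.Basis (Fin N) ℝ (Fin N → ℝ)) (v : Fin N → Fin N → ℤ),
      (∀ i, v i ∈ Λ) ∧ (∀ i, b i = castVec (v i)) ∧
      ∀ x ∈ Λ, ∀ i, b.repr (castVec x) i ≠ 0 → ‖b i‖ ≤ ‖castVec x‖ := by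
  classical
  let S : Set (Fin N → Fin N → ℤ) :=
    {v | (∀ i, v i ∈ Λ) ∧ LinearIndependent ℝ fun i => castVec (v i)}
  have hS : S.Nonempty := by
    refine ⟨fun i => k • Pi.single i 1, fun i => hΛ _, ?_⟩
    have hk' : (k : ℝ) ≠ 0 := by exact_mod_cast hk
    have h1 := (Pi.basisFun ℝ (Fin N)).linearIndependent.units_smul
      (fun _ => Units.mk0 (k : ℝ) hk')
    convert h1 using 2 with i
    rw [castVec_zsmul]
    ext j
    by_cases hij : j = i
    · subst hij
      simp [castVec_apply, Units.smul_def]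
    · simp [castVec_apply, hij]
  obtain ⟨v, ⟨hvΛ, hv⟩, hmin⟩ :=
    (measure fun v : Fin N → Fin N → ℤ => ∑ i, supNatAbs (v i)).wf.has_min S hS
  let b := basisOfLinearIndependentOfCardEqFinrank' _ hv (by simp)
  have hb : ∀ i, b i = castVec (v i) := fun i => by simp [b]
  refine ⟨b, v, hvΛ, hb, fun x hx i hi => ?_⟩
  have hmem : Function.update v i x ∈ S := by
    refine ⟨fun j => ?_, ?_⟩
    · by_cases hj : j = i
      · subst hj
        simpa using hx
      · simpa [hj] using hvΛ j
    · have h1 : LinearIndependent ℝ (Function.update (fun j => castVec (v j)) i (castVec x)) := by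
        refine hv.update i _ ⟨1, one_mem _, b.repr (castVec x), mem_nonZeroDivisors_of_ne_zero hi, ?_⟩
        rw [one_smul]
        conv_lhs => rw [← b.linearCombination_repr (castVec x)]
        congr 2
        funext j
        exact hb j
      convert h1 using 2 with j
      by_cases hj : j = i
      · subst hj
        simp
      · simp [hj]
  have h2 := hmin _ hmem
  simp only [WellFoundedRelation.rel, InvImage, not_lt] at h2
  rw [← Finset.add_sum_erase _ _ (Finset.mem_univ i),
    ← Finset.add_sum_erase _ _ (Finset.mem_univ i)] at h2
  have h3 : ∑ j ∈ Finset.univ.erase i, supNatAbs (Function.update v i x j) =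
      ∑ j ∈ Finset.univ.erase i, supNatAbs (v j) := by
    refine Finset.sum_congr rfl fun j hj => ?_
    rw [Function.update_of_ne (Finset.ne_of_mem_erase hj)]
  rw [h3, Function.update_self] at h2
  rw [hb, norm_castVec, norm_castVec]
  exact_mod_cast (by omega : supNatAbs (v i) ≤ supNatAbs x)

section Reduced

variable {N : ℕ} {Λ : AddSubgroup (Fin N → ℤ)} {b : Module.Basis (Fin N) ℝ (Fin N → ℝ)}
  {v : Fin N → Fin N → ℤ}

theorem norm_le_sum_repr (b : Module.Basis (Fin N) ℝ (Fin N → ℝ)) (x : Fin N → ℝ) :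
    ‖x‖ ≤ ∑ i, |b.repr x i| * ‖b i‖ := by
  conv_lhs => rw [← b.sum_repr x]
  refine (norm_sum_le _ _).trans (le_of_eq ?_)
  simp [norm_smul]

/-- Otherwise `u` would be shorter than the longest basis vector occurring in it, against
reducedness. -/
theorem eq_zero_of_repr_lt (hred : ∀ x ∈ Λ, ∀ i, b.repr (castVec x) i ≠ 0 → ‖b i‖ ≤ ‖castVec x‖)
    (hN : 1 ≤ N) {u : Fin N → ℤ} (hu : u ∈ Λ) (h : ∀ i, |b.repr (castVec u) i| < 1 / N) :
    u = 0 := by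
  classical
  by_contra hne
  set c := b.repr (castVec u) with hc
  have hS : (Finset.univ.filter fun i => c i ≠ 0).Nonempty := by
    by_contra hemp
    rw [Finset.not_nonempty_iff_eq_empty, Finset.filter_eq_empty_iff] at hemp
    apply hne
    apply castVec_injective
    rw [map_zero, ← b.repr.map_eq_zero_iff]
    ext i
    simpa using hemp (Finset.mem_univ i)
  obtain ⟨k, hk, hmax⟩ := Finset.exists_max_image _ (fun i => ‖b i‖) hS
  have hk0 : c k ≠ 0 := by simpa using hk
  have hbk : 0 < ‖b k‖ := norm_pos_iff.2 (b.ne_zero k)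
  have hN0 : (0 : ℝ) < N := by exact_mod_cast hN
  have : ‖castVec u‖ < ‖b k‖ := by
    calc ‖castVec u‖ ≤ ∑ i, |c i| * ‖b i‖ := norm_le_sum_repr b _
      _ < ∑ _i : Fin N, 1 / N * ‖b k‖ := by
        refine Finset.sum_lt_sum_of_nonempty ⟨k, Finset.mem_univ k⟩ fun i _ => ?_
        by_cases hi : c i = 0
        · rw [hi, abs_zero, zero_mul]
          positivity
        · calc |c i| * ‖b i‖ ≤ |c i| * ‖b k‖ := by
                gcongr
                exact hmax i (by simpa using hi)
            _ < 1 / N * ‖b k‖ := by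
                gcongr
                exact h i
      _ = ‖b k‖ := by
        rw [Finset.sum_const, Finset.card_univ, Fintype.card_fin, nsmul_eq_mul]
        field_simp
  exact absurd (hred u hu k hk0) (not_le.2 this)

/-- The coordinates of lattice vectors in a reduced basis have bounded denominators. -/
theorem exists_int_repr (hvΛ : ∀ i, v i ∈ Λ) (hb : ∀ i, b i = castVec (v i))
    (hred : ∀ x ∈ Λ, ∀ i, b.repr (castVec x) i ≠ 0 → ‖b i‖ ≤ ‖castVec x‖)
    (hN : 1 ≤ N) {x : Fin N → ℤ} (hx : x ∈ Λ) (i : Fin N) :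
    ∃ n : ℤ, ((N * (N ^ N).factorial : ℕ) : ℝ) * b.repr (castVec x) i = n := by
  -- Up to coordinates below `1 / N`, the multiple `q • x` is an integer combination of the `v l`;
  -- the difference is then zero, so some `q ≤ N ^ N` clears the denominators.
  obtain ⟨q, hq1, hq, n, hn⟩ :=
    exists_simultaneous_approximation (fun i => b.repr (castVec x) i) hN
  have hrepr : ∀ j, b.repr (castVec ((q : ℤ) • x - ∑ l, n l • v l)) j =
      q * b.repr (castVec x) j - n j := by
    intro j
    rw [map_sub, castVec_zsmul, map_sum]
    simp only [castVec_zsmul, ← hb, map_sub, map_smul, Finsupp.sub_apply, Finsupp.smul_apply,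
      b.repr_sum_self, smul_eq_mul, Int.cast_natCast]
  have h0 : (q : ℤ) • x - ∑ l, n l • v l = 0 := by
    refine eq_zero_of_repr_lt hred hN ?_ fun j => ?_
    · exact Λ.sub_mem (Λ.zsmul_mem hx _) (Λ.sum_mem fun l _ => Λ.zsmul_mem (hvΛ l) _)
    · rw [hrepr]
      exact hn j
  have h1 := hrepr i
  rw [h0] at h1
  simp only [map_zero, Finsupp.coe_zero, Pi.zero_apply] at h1
  obtain ⟨m, hm⟩ := (Nat.dvd_factorial hq1 hq).mul_left N
  refine ⟨m * n i, ?_⟩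
  rw [hm]
  push_cast
  linear_combination (-(m : ℝ)) * h1

/-- The coordinate functionals of a reduced basis are bounded. -/
theorem repr_mul_norm_le (hvΛ : ∀ i, v i ∈ Λ) (hb : ∀ i, b i = castVec (v i))
    (hred : ∀ x ∈ Λ, ∀ i, b.repr (castVec x) i ≠ 0 → ‖b i‖ ≤ ‖castVec x‖)
    (hN : 1 ≤ N) {C : ℝ} (hC : C = 2 * (2 * N) ^ N) (S : Finset (Fin N)) (c : Fin N → ℝ) :
    ∀ i ∈ S, |c i| * ‖b i‖ ≤ C * (1 + C) ^ S.card * ‖∑ j ∈ S, c j • b j‖ := by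
  classical
  have hN0 : (0 : ℝ) < N := by exact_mod_cast hN
  have hC0 : 0 < C := by rw [hC]; positivity
  induction S using Finset.induction_on_max_value (fun i => ‖b i‖) with
  | empty => simp
  | insert a S ha hmax ih =>
    rw [Finset.sum_insert ha, Finset.card_insert_of_notMem ha]
    set y := ∑ j ∈ S, c j • b j with hy
    set x := c a • b a + y with hx
    have hpow : 1 ≤ (1 + C) ^ S.card := one_le_pow₀ (by linarith)
    -- `b a` is the longest vector so far. Approximating the ratios `c l / c a` gives `u ∈ Λ` within
    -- `‖b a‖ / 2` of `(q / c a) • x`. Its coordinate `q` at `a` is non-zero, so `‖u‖ ≥ ‖b a‖`, and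
    -- `x` cannot be short.
    have key : |c a| * ‖b a‖ ≤ C * ‖x‖ := by
      by_cases hca : c a = 0
      · rw [hca, abs_zero, zero_mul]
        positivity
      have hca' : 0 < |c a| := abs_pos.2 hca
      obtain ⟨q, hq1, hq, n, hn⟩ :=
        exists_simultaneous_approximation (fun i => c i / c a) (Q := 2 * N) (by omega)
      set u : Fin N → ℤ := (q : ℤ) • v a + ∑ l ∈ S, n l • v l with hu
      have huΛ : u ∈ Λ :=
        Λ.add_mem (Λ.zsmul_mem (hvΛ a) _) (Λ.sum_mem fun l _ => Λ.zsmul_mem (hvΛ l) _)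
      have hcu : castVec u = (q : ℝ) • b a + ∑ l ∈ S, (n l : ℝ) • b l := by
        rw [hu, map_add, castVec_zsmul, map_sum]
        simp only [castVec_zsmul, ← hb, Int.cast_natCast]
      have hne : b.repr (castVec u) a ≠ 0 := by
        have : b.repr (castVec u) a = q := by
          rw [hcu, map_add, map_sum, Finsupp.add_apply, Finsupp.finsetSum_apply,
            Finset.sum_eq_zero]
          · simp
          · intro l hl
            have : l ≠ a := fun h => ha (h ▸ hl)
            simp [this]
        rw [this]
        exact_mod_cast (by omega : q ≠ 0)
      have hle := hred u huΛ a hne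
      have hdec : castVec u = ((q : ℝ) / c a) • x - ∑ l ∈ S, (q * (c l / c a) - n l) • b l := by
        rw [hcu, hx, hy, smul_add, smul_smul, div_mul_cancel₀ _ hca, Finset.smul_sum,
          add_sub_assoc, ← Finset.sum_sub_distrib]
        congr 1
        refine Finset.sum_congr rfl fun l _ => ?_
        rw [smul_smul, ← sub_smul]
        congr 1
        ring
      have hsum : ‖∑ l ∈ S, (q * (c l / c a) - n l) • b l‖ ≤ ‖b a‖ / 2 := by
        calc _ ≤ ∑ l ∈ S, ‖(q * (c l / c a) - n l) • b l‖ := norm_sum_le _ _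
          _ ≤ ∑ _l ∈ S, 1 / (2 * N) * ‖b a‖ := by
            refine Finset.sum_le_sum fun l hl => ?_
            rw [norm_smul, Real.norm_eq_abs]
            have := (hn l).le
            push_cast at this
            exact mul_le_mul this (hmax l hl) (norm_nonneg _) (by positivity)
          _ = S.card * (1 / (2 * N) * ‖b a‖) := by simp
          _ ≤ N * (1 / (2 * N) * ‖b a‖) := by
            gcongr
            simpa using Finset.card_le_univ S
          _ = ‖b a‖ / 2 := by field_simp
      have hqx : ‖((q : ℝ) / c a) • x‖ ≤ (2 * N) ^ N * ‖x‖ / |c a| := by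
        rw [norm_smul, norm_div, Real.norm_eq_abs, Real.norm_eq_abs, Nat.abs_cast, div_mul_eq_mul_div]
        gcongr
        exact_mod_cast hq
      have h1 : ‖b a‖ ≤ (2 * N) ^ N * ‖x‖ / |c a| + ‖b a‖ / 2 := by
        refine hle.trans ?_
        rw [hdec]
        exact (norm_sub_le _ _).trans (add_le_add hqx hsum)
      have h2 : ‖b a‖ / 2 ≤ (2 * N) ^ N * ‖x‖ / |c a| := by linarith
      rw [le_div_iff₀ hca'] at h2
      rw [hC]
      linarith
    have hyx : ‖y‖ ≤ (1 + C) * ‖x‖ := by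
      have : y = x - c a • b a := by rw [hx]; abel
      rw [this]
      refine (norm_sub_le _ _).trans ?_
      rw [norm_smul, Real.norm_eq_abs]
      linarith
    intro i hi
    rcases Finset.mem_insert.1 hi with rfl | hi
    · refine key.trans ?_
      gcongr
      exact le_mul_of_one_le_right hC0.le (one_le_pow₀ (by linarith))
    · calc |c i| * ‖b i‖ ≤ C * (1 + C) ^ S.card * ‖y‖ := ih i hi
        _ ≤ C * (1 + C) ^ S.card * ((1 + C) * ‖x‖) := by gcongr
        _ = _ := by ring

end Reduced

/-! ### Folding lattice quotients and placing Cayley graphs -/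

theorem abs_fold_sub_fold_le (s t : ℝ) : |(|s - round s|) - (|t - round t|)| ≤ |s - t| := by
  have h1 := round_le s (round t)
  have h2 := round_le t (round s)
  have h3 : |s - round t| ≤ |s - t| + |t - round t| := abs_sub_le _ _ _
  have h4 : |t - round s| ≤ |t - s| + |s - round s| := abs_sub_le _ _ _
  rw [abs_sub_comm t s] at h4
  rw [abs_le]
  constructor <;> linarith

theorem abs_floor_sub_floor_le {s t : ℝ} {B : ℕ} (h : |s - t| ≤ B) : |⌊s⌋ - ⌊t⌋| ≤ (B : ℤ) + 1 := by
  have h1 := Int.floor_le s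
  have h2 := Int.lt_floor_add_one s
  have h3 := Int.floor_le t
  have h4 := Int.lt_floor_add_one t
  rw [abs_le] at h ⊢
  have h5 : (⌊s⌋ : ℝ) - ⌊t⌋ < B + 1 := by linarith
  have h6 : (⌊t⌋ : ℝ) - ⌊s⌋ < B + 1 := by linarith
  have h5' : ⌊s⌋ - ⌊t⌋ < B + 1 := by exact_mod_cast h5
  have h6' : ⌊t⌋ - ⌊s⌋ < B + 1 := by exact_mod_cast h6
  constructor <;> omega

/-- A map of `ℤ^N` to itself that separates the classes modulo `Λ` and nearly factors through the
quotient by `Λ`, whose Lipschitz constant depends on `N` only. -/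
theorem exists_folding (N : ℕ) (hN : 1 ≤ N) :
    ∃ r : ℕ, ∀ (Λ : AddSubgroup (Fin N → ℤ)) (k : ℤ), k ≠ 0 → (∀ z, k • z ∈ Λ) →
      ∃ p : (Fin N → ℤ) → Fin N → ℤ, (∀ z j, 0 ≤ p z j) ∧
        (∀ z z' i, z' - (z + Pi.single i 1) ∈ Λ → ∀ j, |p z' j - p z j| ≤ r) ∧
        ∀ z z', p z = p z' → z - z' ∈ Λ := by
  classical
  -- The factorial clears the denominators of `exists_int_repr`; the factor `N` gives `N / M ≤ 1` in
  -- the separation argument.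
  set M : ℕ := N * (N ^ N).factorial with hM
  have hMN : N ≤ M := Nat.le_mul_of_pos_right _ (Nat.factorial_pos _)
  have hM0 : 0 < M := by omega
  have hM0' : (0 : ℝ) < M := by exact_mod_cast hM0
  set C : ℝ := 2 * (2 * N) ^ N with hC
  set B : ℕ := ⌈M * (C * (1 + C) ^ N)⌉₊ with hB
  refine ⟨2 * M * (B + 1) + 2 * M, fun Λ k hk hΛ => ?_⟩
  obtain ⟨b, v, hvΛ, hb, hred⟩ := exists_reduced_basis Λ hk hΛ
  -- `y` is integral on `Λ`, so its distance to the nearest integer, rescaled to `f`, folds the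
  -- torus onto a box. What folding forgets is kept in `s`: the side of the nearest integer and that
  -- integer modulo `M`.
  let y : (Fin N → ℤ) → Fin N → ℝ := fun z i => M * b.repr (castVec z) i
  let f : (Fin N → ℤ) → Fin N → ℤ := fun z i => ⌊‖b i‖ * |y z i - round (y z i)|⌋
  let s : (Fin N → ℤ) → Fin N → ℤ := fun z i =>
    2 * (round (y z i) % (M : ℤ)) + if 0 ≤ y z i - round (y z i) then 1 else 0
  have hysub : ∀ z z' i, y (z - z') i = y z i - y z' i := fun z z' i => by
    simp only [y, map_sub, Finsupp.sub_apply]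
    ring
  have hf0 : ∀ z i, 0 ≤ f z i := fun z i => Int.floor_nonneg.2 (by positivity)
  have hs : ∀ z i, 0 ≤ s z i ∧ s z i < 2 * M := fun z i => by
    have h1 := Int.emod_nonneg (round (y z i)) (show (M : ℤ) ≠ 0 by omega)
    have h2 := Int.emod_lt_of_pos (round (y z i)) (show (0 : ℤ) < M by omega)
    simp only [s]
    split_ifs <;> constructor <;> omega
  have hfΛ : ∀ z z', z - z' ∈ Λ → f z = f z' := by
    intro z z' hz
    funext i
    obtain ⟨n, hn⟩ := exists_int_repr hvΛ hb hred hN hz i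
    have h1 : y z i = y z' i + n := by
      rw [← hn]
      have := hysub z z' i
      simp only [y] at this ⊢
      linarith
    simp only [f]
    rw [h1, round_add_intCast]
    push_cast
    rw [add_sub_add_right_eq_sub]
  have hfLip : ∀ z i j, |f (z + Pi.single i 1) j - f z j| ≤ (B : ℤ) + 1 := by
    intro z i j
    refine abs_floor_sub_floor_le ?_
    rw [← mul_sub, abs_mul, abs_of_nonneg (norm_nonneg _)]
    have h1 := abs_fold_sub_fold_le (y (z + Pi.single i 1) j) (y z j)
    rw [← hysub, add_sub_cancel_left] at h1
    have h2 := repr_mul_norm_le hvΛ hb hred hN hC Finset.univ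
      (fun l => b.repr (castVec (Pi.single i 1)) l) j (Finset.mem_univ j)
    rw [b.sum_repr, Finset.card_univ, Fintype.card_fin] at h2
    have h3 : ‖castVec (Pi.single i 1 : Fin N → ℤ)‖ ≤ 1 := by
      refine (pi_norm_le_iff_of_nonneg zero_le_one).2 fun l => ?_
      rw [castVec_apply]
      by_cases hl : l = i
      · subst hl
        simp
      · simp [hl]
    have hC0 : 0 ≤ C := by rw [hC]; positivity
    calc _ ≤ ‖b j‖ * |y (Pi.single i 1) j| := by gcongr
      _ = M * (|b.repr (castVec (Pi.single i 1)) j| * ‖b j‖) := by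
        simp only [y]
        rw [abs_mul, abs_of_pos hM0']
        ring
      _ ≤ M * (C * (1 + C) ^ N * 1) := by
        refine mul_le_mul_of_nonneg_left (h2.trans ?_) hM0'.le
        gcongr
      _ ≤ B := by
        rw [mul_one]
        exact Nat.le_ceil _
  -- Since `0 ≤ s < 2 * M`, both `f` and `s` can be recovered, while jumps of `s` cost less than `2
  -- * M`.
  refine ⟨fun z j => 2 * M * f z j + s z j, fun z j => ?_, fun z z' i hz j => ?_,
    fun z z' hzz => ?_⟩
  · have := hf0 z j
    have := (hs z j).1
    positivity
  · have h1 := hfLip z i j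
    have h2 := hs z j
    have h3 := hs z' j
    rw [← congrFun (hfΛ _ _ hz) j] at h1
    have h4 : |2 * (M : ℤ) * (f z' j - f z j)| ≤ 2 * M * (B + 1) := by
      rw [abs_mul, abs_of_nonneg (by positivity)]
      gcongr
    push_cast
    rw [abs_le] at h4 ⊢
    constructor <;> linarith
  · have hsplit : ∀ i, f z i = f z' i ∧ s z i = s z' i := by
      intro i
      have h0 : s z i + 2 * M * f z i = s z' i + 2 * M * f z' i := by
        have := congrFun hzz i
        simp only at this
        linarith
      have h1 := hs z i
      have h2 := hs z' i
      have h3 : s z i = s z' i := by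
        have := congrArg (· % (2 * (M : ℤ))) h0
        simp only [Int.add_mul_emod_self_left] at this
        rwa [Int.emod_eq_of_lt h1.1 h1.2, Int.emod_eq_of_lt h2.1 h2.2] at this
      refine ⟨?_, h3⟩
      rw [h3] at h0
      have h4 : 2 * (M : ℤ) * f z i = 2 * M * f z' i := by linarith
      exact mul_left_cancel₀ (by positivity) h4
    have hround : ∀ i, ∃ n : ℤ, round (y z i) - round (y z' i) = M * n := by
      intro i
      have h1 := (hsplit i).2
      have h2 : round (y z i) % (M : ℤ) = round (y z' i) % (M : ℤ) := by
        simp only [s] at h1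
        split_ifs at h1 <;> omega
      exact Int.ModEq.dvd (Int.ModEq.symm h2)
    choose n hn using hround
    -- Equal codes put `z - z'` at distance less than `N / M ≤ 1` from a point of `Λ`; integer
    -- vectors that close coincide.
    set w : Fin N → ℤ := z - z' - ∑ l, n l • v l with hw
    have hwrepr : ∀ i, M * b.repr (castVec w) i =
        (y z i - round (y z i)) - (y z' i - round (y z' i)) := by
      intro i
      have h1 : ((round (y z i) : ℝ) - round (y z' i)) = M * n i := by exact_mod_cast hn i
      have h2 := hysub z z' i
      rw [hw, map_sub, map_sum]
      simp only [castVec_zsmul, ← hb, map_sub (b.repr), Finsupp.sub_apply, b.repr_sum_self]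
      simp only [y] at h1 h2 ⊢
      rw [mul_sub, h2]
      linarith
    have hwlt : ∀ i, |b.repr (castVec w) i| * ‖b i‖ < 1 / M := by
      intro i
      have h1 := Int.abs_sub_lt_one_of_floor_eq_floor (hsplit i).1
      rw [← mul_sub, abs_mul, abs_of_nonneg (norm_nonneg _)] at h1
      have h2 : |(|y z i - round (y z i)|) - (|y z' i - round (y z' i)|)| =
          |(y z i - round (y z i)) - (y z' i - round (y z' i))| := by
        have h3 := (hsplit i).2
        simp only [s] at h3
        split_ifs at h3 with h4 h5 h5
        · rw [abs_of_nonneg h4, abs_of_nonneg h5]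
        · omega
        · omega
        · rw [abs_of_neg (not_le.1 h4), abs_of_neg (not_le.1 h5), neg_sub_neg, abs_sub_comm]
      rw [h2, ← hwrepr, abs_mul, abs_of_pos hM0'] at h1
      rw [lt_div_iff₀ hM0']
      linarith
    have hw0 : w = 0 := by
      have h1 : ‖castVec w‖ < 1 := by
        calc ‖castVec w‖ ≤ ∑ i, |b.repr (castVec w) i| * ‖b i‖ := norm_le_sum_repr b _
          _ < ∑ _i : Fin N, 1 / (M : ℝ) :=
            Finset.sum_lt_sum_of_nonempty ⟨⟨0, hN⟩, Finset.mem_univ _⟩ fun i _ => hwlt i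
          _ = N / M := by
            rw [Finset.sum_const, Finset.card_univ, Fintype.card_fin, nsmul_eq_mul, mul_one_div]
          _ ≤ 1 := by
            rw [div_le_one hM0']
            exact_mod_cast hMN
      rw [norm_castVec] at h1
      have h2 : supNatAbs w = 0 := by
        have : supNatAbs w < 1 := by exact_mod_cast h1
        omega
      ext i
      have h3 := Finset.le_sup (f := fun i => (w i).natAbs) (Finset.mem_univ i)
      change (w i).natAbs ≤ supNatAbs w at h3
      rw [Pi.zero_apply]
      omega
    have h1 : z - z' = ∑ l, n l • v l := sub_eq_zero.1 (hw.symm.trans hw0)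
    rw [h1]
    exact Λ.sum_mem fun l _ => Λ.zsmul_mem (hvΛ l) _

/-- Cayley graphs of finite abelian groups with `N` generators embed into `ℤ^N`, with edges of
length bounded in terms of `N`. -/
theorem exists_cayley_embedding (N : ℕ) (hN : 1 ≤ N) :
    ∃ r : ℕ, ∀ (G : Type*) [AddCommGroup G] [Finite G] (g : Fin N → G),
      ∃ pos : G → Fin N → ℤ, Function.Injective pos ∧
        ∀ x i j, |pos (x + g i) j - pos x j| ≤ r := by
  classical
  obtain ⟨r, hr⟩ := exists_folding N hN
  refine ⟨r, fun G _ _ g => ?_⟩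
  have := Fintype.ofFinite G
  let φ : (Fin N → ℤ) →+ G := (Fintype.linearCombination ℤ g).toAddMonoidHom
  have hφ : ∀ i, φ (Pi.single i 1) = g i := fun i => by
    simp [φ]
  obtain ⟨p, hp0, hpLip, hpinj⟩ := hr φ.ker (Fintype.card G) (by exact_mod_cast Fintype.card_ne_zero)
    (fun z => by
      rw [AddMonoidHom.mem_ker, map_zsmul, natCast_zsmul, card_nsmul_eq_zero])
  -- The `g i` may generate a proper subgroup. Each coset gets its own copy of the folded torus,
  -- translated along the first axis by a multiple of `L`, which exceeds the extent of a copy.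
  let ρ : G → G := fun x => (x : G ⧸ φ.range).out
  have hρ : ∀ x, ∃ z, φ z = x - ρ x := fun x => by
    have h1 : ((ρ x : G) : G ⧸ φ.range) = x := Quotient.out_eq' _
    have h2 := QuotientAddGroup.eq.1 h1
    rw [neg_add_eq_sub] at h2
    exact h2
  choose ζ hζ using hρ
  have hρg : ∀ x i, ρ (x + g i) = ρ x := fun x i => by
    have : ((x + g i : G) : G ⧸ φ.range) = x := by
      rw [QuotientAddGroup.eq]
      refine ⟨-Pi.single i 1, ?_⟩
      rw [map_neg, hφ]
      abel
    simp only [ρ, this]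
  let e := Fintype.equivFin G
  let o : Fin N := ⟨0, hN⟩
  let L : ℤ := 1 + ∑ x, p (ζ x) o
  have hL : ∀ x, p (ζ x) o < L := fun x => by
    have := Finset.single_le_sum (f := fun x => p (ζ x) o) (fun x _ => hp0 _ _) (Finset.mem_univ x)
    exact lt_of_le_of_lt this (lt_one_add _)
  refine ⟨fun x j => p (ζ x) j + L * if j = o then (e (ρ x) : ℕ) else 0, ?_, ?_⟩
  · intro x x' hxx
    have h0 := congrFun hxx o
    simp only [if_true] at h0
    have hLpos : 0 < L := (hp0 (ζ x) o).trans_lt (hL x)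
    have h1 := congrArg (· / L) h0
    simp only [Int.add_mul_ediv_left _ _ hLpos.ne', Int.ediv_eq_zero_of_lt (hp0 _ _) (hL _),
      zero_add] at h1
    have h2 : ρ x = ρ x' := e.injective (Fin.ext (by exact_mod_cast h1))
    have h3 : p (ζ x) = p (ζ x') := by
      funext j
      have := congrFun hxx j
      simp only [h2] at this
      exact add_right_cancel this
    have h4 := hpinj _ _ h3
    rw [AddMonoidHom.mem_ker, map_sub, hζ, hζ, h2] at h4
    simpa [sub_eq_zero] using h4
  · intro x i j
    simp only [hρg]
    rw [add_sub_add_right_eq_sub]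
    refine hpLip _ _ i ?_ j
    rw [AddMonoidHom.mem_ker, map_sub, map_add, hζ, hζ, hφ, hρg]
    abel

/-! ### Locality of generalized bicycle codes -/

theorem Finset.exists_fin_cover {G : Type*} [Zero G] (T : Finset G) {D : ℕ} (h : T.card ≤ D) :
    ∃ g : Fin D → G, ∀ t ∈ T, ∃ i, g i = t := by
  -- Spare slots hold `0`, a displacement that moves nothing.
  refine ⟨fun i => T.toList.getD i 0, fun t ht => ?_⟩
  obtain ⟨i, hi, rfl⟩ := List.mem_iff_getElem.1 (Finset.mem_toList.2 ht)
  refine ⟨⟨i, lt_of_lt_of_le hi (by simpa using h)⟩, ?_⟩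
  exact List.getD_eq_getElem _ _ hi

namespace GB

variable {F : Type*} [Field F]

theorem exists_mem_support_of_circ_ne_zero {ℓ : ℕ} [NeZero ℓ] {a : Polynomial F} {i j : ZMod ℓ}
    (h : circ ℓ a i j ≠ 0) : ∃ e ∈ a.support, i = j + (e : ZMod ℓ) := by
  refine ⟨(i - j).val, Polynomial.mem_support_iff.2 h, ?_⟩
  rw [ZMod.natCast_zmod_val]
  abel

/-- A placement of `ℤ/ℓ` in which differences of exponents are short gives a local placement of
the qudits of `GB(a, b)`. -/
theorem isLocal_of_placement {ℓ : ℕ} [NeZero ℓ] {a b : Polynomial F} {D r : ℕ}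
    (P : ZMod ℓ → Fin D → ℤ) (hP : Function.Injective P) (e₀ f₀ : ZMod ℓ)
    (ha : ∀ e ∈ a.support, ∀ x j, |P (x + ((e : ZMod ℓ) - e₀)) j - P x j| ≤ (r : ℤ))
    (hb : ∀ f ∈ b.support, ∀ x j, |P (x + ((f : ZMod ℓ) - f₀)) j - P x j| ≤ (r : ℤ)) :
    (code ℓ a b).IsLocal D 2 (2 * r) := by
  -- With the blocks shifted by reference exponents, the `X` check centred at `P i` and the `Z`
  -- check centred at `P (i + e₀ + f₀)` see only the differences `e - e₀` and `f - f₀`.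
  let pos : ZMod ℓ ⊕ ZMod ℓ → Fin D → ℤ := Sum.elim (fun x => P (x + e₀)) fun y => P (y + f₀)
  have hX : ∀ i p, (code ℓ a b).HX i p ≠ 0 → ∀ j, |pos p j - P i j| ≤ (r : ℤ) := by
    rintro i (x | y) h j
    · obtain ⟨e, he, rfl⟩ := exists_mem_support_of_circ_ne_zero (show circ ℓ a i x ≠ 0 from h)
      have := ha e he (x + e₀) j
      rwa [abs_sub_comm, show x + e₀ + ((e : ZMod ℓ) - e₀) = x + e by abel] at this
    · obtain ⟨f, hf, rfl⟩ := exists_mem_support_of_circ_ne_zero (show circ ℓ b i y ≠ 0 from h)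
      have := hb f hf (y + f₀) j
      rwa [abs_sub_comm, show y + f₀ + ((f : ZMod ℓ) - f₀) = y + f by abel] at this
  have hZ : ∀ i p, (code ℓ a b).HZ i p ≠ 0 → ∀ j, |pos p j - P (i + e₀ + f₀) j| ≤ (r : ℤ) := by
    rintro i (x | y) h j
    · obtain ⟨f, hf, rfl⟩ := exists_mem_support_of_circ_ne_zero (show circ ℓ b x i ≠ 0 from h)
      have := hb f hf (i + e₀ + f₀) j
      rwa [show i + e₀ + f₀ + ((f : ZMod ℓ) - f₀) = i + f + e₀ by abel] at this
    · obtain ⟨e, he, rfl⟩ := exists_mem_support_of_circ_ne_zero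
        (show circ ℓ a y i ≠ 0 from fun h0 => h (by
          change -circ ℓ a y i = 0
          rw [h0, neg_zero]))
      have := ha e he (i + e₀ + f₀) j
      rwa [show i + e₀ + f₀ + ((e : ZMod ℓ) - e₀) = i + e + f₀ by abel] at this
  refine ⟨pos, fun x => ?_, fun i p p' h h' j => ?_, fun i p p' h h' j => ?_⟩
  · have : ({p | pos p = x} : Set _).ncard ≤ (Set.univ : Set Bool).ncard := by
      refine Set.ncard_le_ncard_of_injOn Sum.isLeft (fun _ _ => Set.mem_univ _) ?_ (Set.toFinite _)
      rintro (u | u) hu (u' | u') hu' huu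
      · have := hP (hu.trans hu'.symm)
        rw [add_right_cancel this]
      · simp at huu
      · simp at huu
      · have := hP (hu.trans hu'.symm)
        rw [add_right_cancel this]
    simpa using this
  · have h1 := hX i p h j
    have h2 := hX i p' h' j
    push_cast
    rw [abs_le] at *
    constructor <;> linarith
  · have h1 := hZ i p h j
    have h2 := hZ i p' h' j
    push_cast
    rw [abs_le] at *
    constructor <;> linarith

/-- Generalized bicycle codes are local in as many dimensions as there are exponents besides one
reference exponent in each of the two polynomials. -/
theorem exists_isLocal (D : ℕ) (hD : 1 ≤ D) :
    ∃ r : ℕ, ∀ (F : Type*) [Field F] (ℓ : ℕ) [NeZero ℓ] (a b : Polynomial F),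
      (a.support.card - 1) + (b.support.card - 1) ≤ D → (code ℓ a b).IsLocal D 2 r := by
  classical
  obtain ⟨r, hr⟩ := exists_cayley_embedding D hD
  refine ⟨2 * r, fun F _ ℓ _ a b hw => ?_⟩
  -- The leading exponent is the reference; its own displacement is zero and needs no generator.
  let diffs : Polynomial F → Finset (ZMod ℓ) := fun p =>
    (p.support.erase p.natDegree).image fun e : ℕ => (e : ZMod ℓ) - p.natDegree
  have hcard : ∀ p : Polynomial F, (diffs p).card ≤ p.support.card - 1 := by
    intro p
    refine Finset.card_image_le.trans ?_
    by_cases hp : p = 0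
    · simp [hp]
    · rw [Finset.card_erase_of_mem (Polynomial.natDegree_mem_support_of_nonzero hp)]
  obtain ⟨g, hg⟩ := Finset.exists_fin_cover (diffs a ∪ diffs b) (D := D)
    ((Finset.card_union_le _ _).trans ((add_le_add (hcard a) (hcard b)).trans hw))
  obtain ⟨P, hP, hPg⟩ := hr (ZMod ℓ) g
  have key : ∀ p : Polynomial F, diffs p ⊆ diffs a ∪ diffs b → ∀ e ∈ p.support, ∀ x j,
      |P (x + ((e : ZMod ℓ) - p.natDegree)) j - P x j| ≤ (r : ℤ) := by
    intro p hp e he x j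
    by_cases hep : e = p.natDegree
    · rw [hep, sub_self, add_zero, sub_self, abs_zero]
      positivity
    · obtain ⟨i, hi⟩ := hg _ (hp (Finset.mem_image_of_mem _ (Finset.mem_erase.2 ⟨hep, he⟩)))
      rw [← hi]
      exact hPg x i j
  exact isLocal_of_placement P hP _ _ (key a Finset.subset_union_left)
    (key b Finset.subset_union_right)

theorem ParameterBounds.mono {ℓ : ℕ} [NeZero ℓ] {a b : Polynomial F} {D : ℕ} {K K' : ℝ}
    (h : ParameterBounds ℓ a b D K) (hK : K ≤ K') : ParameterBounds ℓ a b D K' := by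
  refine ⟨h.1.trans ?_, fun hD => (h.2 hD).trans ?_⟩ <;> gcongr

end GB

/-! ### Local representations combined with the trade-offs -/

theorem mainTheorem1 :
    -- for each weight, a local representation with the corresponding bounds;
    -- the constants `r` and `K` depend on `w` only
    (∀ w : ℕ, 2 ≤ w → ∃ (r : ℕ) (K : ℝ),
      ∀ (F : Type*) [Field F] [Fintype F] (ℓ : ℕ) [NeZero ℓ] (a b : Polynomial F),
        a.natDegree < ℓ → b.natDegree < ℓ → GB.rowWeight a b = w → GB.Incommensurate ℓ a b →
        ∃ D : ℕ, 1 ≤ D ∧ D + 1 ≤ w ∧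
          (ℓ.Prime → a ≠ 0 → b ≠ 0 → 3 ≤ w → D + 2 ≤ w) ∧
          (GB.code ℓ a b).EquivalentToLocal D 2 r ∧
          (0 < (GB.code ℓ a b).numLogical → GB.ParameterBounds ℓ a b D K)) ∧
    -- the bounds hold with every dimension in which the code has a local representation
    (∀ D m r : ℕ, 1 ≤ D → ∃ K : ℝ,
      ∀ (F : Type*) [Field F] [Fintype F] (ℓ : ℕ) [NeZero ℓ] (a b : Polynomial F),
        a.natDegree < ℓ → b.natDegree < ℓ →
        (GB.code ℓ a b).EquivalentToLocal D m r →
        0 < (GB.code ℓ a b).numLogical → GB.ParameterBounds ℓ a b D K) ∧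
    -- families of fixed weight whose distance tends to infinity have rate tending to zero
    (∀ (w : ℕ) (F : ℕ → Type*) [∀ i, Field (F i)] [∀ i, Fintype (F i)]
      (ℓ : ℕ → ℕ) [∀ i, NeZero (ℓ i)] (a b : ∀ i, Polynomial (F i)),
        (∀ i, (a i).natDegree < ℓ i) → (∀ i, (b i).natDegree < ℓ i) →
        (∀ i, GB.rowWeight (a i) (b i) = w) →
        Filter.Tendsto (fun i => (GB.code (ℓ i) (a i) (b i)).distance)
          Filter.atTop Filter.atTop →
        Filter.Tendsto
          (fun i => ((GB.code (ℓ i) (a i) (b i)).numLogical : ℝ) / (2 * ℓ i : ℝ))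
          Filter.atTop (nhds 0)) := by
  refine ⟨fun w hw => ?_, fun D m r hD => ?_, ?_⟩
  · obtain ⟨r₁, hr₁⟩ := GB.exists_isLocal (w - 1) (by omega)
    -- The maximum matters only for `w = 2`, where two monomials would leave dimension zero.
    obtain ⟨r₂, hr₂⟩ := GB.exists_isLocal (max (w - 2) 1) (le_max_right _ _)
    obtain ⟨K₁, -, hK₁⟩ := GB.exists_parameterBounds (w - 1) 2 (max r₁ r₂) (by omega)
    obtain ⟨K₂, -, hK₂⟩ := GB.exists_parameterBounds (max (w - 2) 1) 2 (max r₁ r₂) (le_max_right _ _)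
    refine ⟨max r₁ r₂, max K₁ K₂, fun F _ _ ℓ _ a b _ _ hwt _ => ?_⟩
    unfold GB.rowWeight at hwt
    by_cases h : a ≠ 0 ∧ b ≠ 0
    · have ha : 0 < a.support.card := by simpa [Finset.card_pos] using h.1
      have hb : 0 < b.support.card := by simpa [Finset.card_pos] using h.2
      have hloc := ((hr₂ F ℓ a b (by omega)).mono (le_max_right r₁ r₂)).equivalentToLocal
      exact ⟨max (w - 2) 1, le_max_right _ _, by omega, fun _ _ _ _ => by omega, hloc,
        fun hk => (hK₂ F ℓ a b hloc hk).mono (le_max_right _ _)⟩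
    · have hcard : (a.support.card - 1) + (b.support.card - 1) ≤ w - 1 := by
        omega
      have hloc := ((hr₁ F ℓ a b hcard).mono (le_max_left r₁ r₂)).equivalentToLocal
      exact ⟨w - 1, by omega, by omega, fun _ h1 h2 _ => absurd ⟨h1, h2⟩ h, hloc,
        fun hk => (hK₁ F ℓ a b hloc hk).mono (le_max_left _ _)⟩
  · obtain ⟨K, -, hK⟩ := GB.exists_parameterBounds D m r hD
    exact ⟨K, fun F _ _ ℓ _ a b _ _ hloc hk => hK F ℓ a b hloc hk⟩
  · intro w F _ _ ℓ _ a b _ _ hwt hd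
    -- The dimension need not be optimal; `w + 2 ≥ 2` makes the second inequality available for
    -- every `w`, with positive exponent `2 / (w + 1)`.
    obtain ⟨r, hr⟩ := GB.exists_isLocal (w + 2) (by omega)
    obtain ⟨K, hK0, hK⟩ := GB.exists_parameterBounds (w + 2) 2 r (by omega)
    set α : ℝ := 2 / (((w + 2 : ℕ) : ℝ) - 1) with hα
    have hα0 : 0 < α := by
      rw [hα]
      push_cast
      have : (0 : ℝ) ≤ w := by positivity
      exact div_pos two_pos (by linarith)
    have hlim : Filter.Tendsto
        (fun i => K / ((GB.code (ℓ i) (a i) (b i)).distance : ℝ) ^ α) Filter.atTop (nhds 0) :=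
      ((tendsto_rpow_atTop hα0).comp (tendsto_natCast_atTop_atTop.comp hd)).const_div_atTop K
    refine tendsto_of_tendsto_of_tendsto_of_le_of_le' tendsto_const_nhds hlim
      (Filter.Eventually.of_forall fun i => by positivity) ?_
    filter_upwards [hd.eventually_ge_atTop 1] with i hi
    have hi' : (0 : ℝ) < (GB.code (ℓ i) (a i) (b i)).distance := by exact_mod_cast hi
    have hℓ : (0 : ℝ) < 2 * ℓ i := by
      have : (0 : ℝ) < ℓ i := by exact_mod_cast NeZero.pos (ℓ i)
      linarith
    rcases Nat.eq_zero_or_pos (GB.code (ℓ i) (a i) (b i)).numLogical with h0 | hk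
    · rw [h0, Nat.cast_zero, zero_div]
      positivity
    · have hw := hwt i
      unfold GB.rowWeight at hw
      have hloc := (hr (F i) (ℓ i) (a i) (b i) (by omega)).equivalentToLocal
      have := (hK (F i) (ℓ i) (a i) (b i) hloc hk).2 (by omega)
      rw [div_le_div_iff₀ hℓ (by positivity)]
      exact this
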